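/- Let $d\ge 1$ be an integer, let $X=(X_{ab})_{a,b\ge 1}$ be the infinite matrix of commuting variables, and let $p_k=\operatorname{tr}(X^k)=\sum_{a_1,\dots,a_k\ge 1}X_{a_1a_2}X_{a_2a_3}\cdots X_{a_ka_1}$ for $k\ge 1$, a formal power series in the $X_{ab}$. For a partition $\alpha=(\alpha_1,\dots,\alpha_m)$ put $\Phi(\alpha)=p_{\alpha_1}\cdots p_{\alpha_m}$. Let $$W([d])=\frac1d\,{:}\operatorname{tr}(D^d){:}=\frac1d\sum_{a_1,\dots,a_d\ge1}\ \sum_{e_1,\dots,e_d\ge1}\Bigl(\prod_{i=1}^d X_{a_ie_i}\Bigr)\prod_{i=1}^d\frac{\partial}{\partial X_{a_{i+1}e_i}}\qquad(a_{d+1}=a_1),$$ the normally ordered trace of the $d$-th power of the matrix $D=(D_{ab})$, $D_{ab}=\sum_{c\ge 1}X_{ac}\,\partial/\partial X_{bc}$; it acts on $\mathbb C[[z,X_{ab}]]_{a,b\ge1}$, because in the sum defining a given coefficient of $W([d])F$ only finitely many terms are non-zero. For $n\ge1$, $k\ge0$ and a partition $\alpha$ of $n$ let $h^{[d]}_k(\alpha)=\mathrm{Cov}(1^{n-d}d,\dots,1^{n-d}d,\alpha)$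 be the number of tuples $(\sigma_1,\dots,\sigma_k,\sigma)\in S_n^{k+1}$ such that each $\sigma_i$ is of cycle type $1^{n-d}d$ (no such permutation exists if $d>n$), $\sigma$ is of cycle type $\alpha$, $\sigma_1\cdots\sigma_k\sigma=1$, and the subgroup generated by $\sigma_1,\dots,\sigma_k,\sigma$ acts transitively on $\{1,\dots,n\}$. Put $$H^{[d]}(z,p)=\sum_{n\ge1}\frac1{n!}\sum_{k\ge0}\ \sum_{\alpha\vdash n}h^{[d]}_k(\alpha)\,\frac{z^k}{k!}\,\Phi(\alpha)\in\mathbb C[[z,X_{ab}]],\qquad \hat H^{[d]}=e^{H^{[d]}}.$$ Then $\hat H^{[d]}$ is the solution, unique in $\mathbb C[[z,X_{ab}]]_{a,b\ge1}$, of the differential equation $$\frac{\partial\hat H^{[d]}}{\partial z}=W([d])\,\hat H^{[d]}$$ with the initial condition $\hat H^{[d]}(0,p)=e^{p_1}$. -/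

import Mathlib

namespace WOp

/-- The variables: the time variable `z`, and the entries `X a b` (`a, b ≥ 1`) of the infinite
variable matrix. -/
inductive Var : Type
  | z : Var
  | X (a b : ℕ+) : Var

/-- The ring `ℂ[[z, X_{ab}]]_{a,b ≥ 1}` of formal power series. -/
abbrev Ser : Type := MvPowerSeries Var ℂ

/-- The variable `z`. -/
noncomputable def zVar : Ser := MvPowerSeries.X Var.z

/-- The matrix entry `X_{ab}`. -/
noncomputable def xVar (a b : ℕ+) : Ser := MvPowerSeries.X (Var.X a b)

/-- A family of formal power series is locally finite if every monomial occurs in only finitely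
many members. -/
def LocallyFinite {ι : Type} (f : ι → Ser) : Prop :=
  ∀ m : Var →₀ ℕ, {i | MvPowerSeries.coeff m (f i) ≠ 0}.Finite

/-- The sum of a (locally finite) infinite family of formal power series, coefficientwise. -/
noncomputable def formalSum {ι : Type} (f : ι → Ser) : Ser :=
  fun m => ∑ᶠ i, MvPowerSeries.coeff m (f i)

/-- The monomial `X_{(a_1,…,a_k)} = X_{a_1 a_2} X_{a_2 a_3} ⋯ X_{a_k a_1}`. -/
noncomputable def cyclicMonomial {k : ℕ} (a : Fin k → ℕ+) : Ser :=
  ∏ i, xVar (a i) (a (finRotate k i))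

/-- `p_k = tr (X ^ k)`, for `k ≥ 1`: the sum of `X_{a_1 a_2} X_{a_2 a_3} ⋯ X_{a_k a_1}` over all
`a_1, …, a_k ≥ 1`. -/
noncomputable def p (k : ℕ) : Ser :=
  formalSum fun a : Fin k → ℕ+ => cyclicMonomial a

/-- The summand `∏_i X_{a_i e_i} ∏_i ∂/∂X_{b_i e_i}` of the normally ordered product
`:∏_i D_{a_i b_i}:`, where `D_{ab} = ∑_c X_{ac} ∂/∂X_{bc}`. -/
noncomputable def normalOrderedTerm {d : ℕ} (a b e : Fin d → ℕ+) (F : Ser) : Ser :=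
  (∏ i, xVar (a i) (e i)) *
    ((List.ofFn fun i => ((MvPowerSeries.pderiv ℂ (Var.X (b i) (e i)) : Derivation ℂ Ser Ser) :
      Module.End ℂ Ser)).prod) F

/-- The operator `W([d]) = (1/d) :tr(D^d):`, that is
`(1/d) ∑_{a_1,…,a_d} :D_{a_1 a_2} D_{a_2 a_3} ⋯ D_{a_d a_1}:`. -/
noncomputable def W (d : ℕ) (F : Ser) : Ser :=
  ((1 : ℂ) / d) • formalSum fun q : (Fin d → ℕ+) × (Fin d → ℕ+) =>
    normalOrderedTerm q.1 (fun i => q.1 (finRotate d i)) q.2 F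

/-- `Cov n Λ` is the number of `m`-tuples `(σ_1, …, σ_m)` of permutations of `n` points such that
`σ_i` has cycle lengths `Λ_i` (fixed points included), `σ_1 ⋯ σ_m = 1`, and the subgroup generated
by the `σ_i` is transitive. -/
noncomputable def Cov (n : ℕ) {m : ℕ} (Λ : Fin m → Multiset ℕ) : ℕ :=
  Nat.card {σ : Fin m → Equiv.Perm (Fin n) //
    (∀ i, (σ i).partition.parts = Λ i) ∧ (List.ofFn σ).prod = 1 ∧
      MulAction.IsPretransitive (Subgroup.closure (Set.range σ)) (Fin n)}

/-- The type `1^{n-d} d`.  It is the type of a permutation of `n` points only if `d ≤ n`. -/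
def cycleParts (n d : ℕ) : Multiset ℕ := d ::ₘ Multiset.replicate (n - d) 1

/-- `h^{[d]}_k(α) = Cov(1^{n-d}d, …, 1^{n-d}d, α)` with `k` entries `1^{n-d}d`. -/
noncomputable def hurwitz (d k : ℕ) {n : ℕ} (α : n.Partition) : ℕ :=
  Cov n (Fin.snoc (α := fun _ => Multiset ℕ) (fun _ : Fin k => cycleParts n d) α.parts)

/-- `p_α = p_{α_1} ⋯ p_{α_m}`, the value of `Φ` on a permutation of type `α`. -/
noncomputable def pPart {n : ℕ} (α : n.Partition) : Ser := (α.parts.map p).prod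

/-- The summand of index `(n, k)` of the generating function of the `h^{[d]}_k(α)`. -/
noncomputable def hTerm (d : ℕ) (q : ℕ+ × ℕ) : Ser :=
  ∑ α : (q.1 : ℕ).Partition,
    ((1 / ((q.1 : ℕ).factorial : ℂ)) * (hurwitz d q.2 α : ℂ) * (1 / (q.2.factorial : ℂ))) •
      (zVar ^ q.2 * pPart α)

/-- `H^{[d]} = ∑_{n ≥ 1} (1/n!) ∑_{k ≥ 0} ∑_{α ⊢ n} h^{[d]}_k(α) (z^k / k!) p_α`. -/
noncomputable def H (d : ℕ) : Ser := formalSum (hTerm d)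

/-- `e^F` for a formal power series `F` without constant term. -/
noncomputable def expSeries (F : Ser) : Ser := (PowerSeries.exp ℂ).subst F

/-- `Ĥ^{[d]} = e^{H^{[d]}}`. -/
noncomputable def Hhat (d : ℕ) : Ser := expSeries (H d)

/-- The partial derivative with respect to `z`. -/
noncomputable def dz (F : Ser) : Ser := MvPowerSeries.pderiv ℂ Var.z F

/-- The series `F(0, ·)` obtained by setting `z = 0`. -/
noncomputable def atZero (F : Ser) : Ser :=
  fun m => if m Var.z = 0 then MvPowerSeries.coeff m F else 0

/-! ### The infinite sums above are locally finite, and the exponentials are defined -/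

/-- If every `X_{u_i v_i}` divides a series, they all occur in each of its monomials. -/
theorem ne_zero_of_coeff {k : ℕ} {u v : Fin k → ℕ+} {G : Ser} {m : Var →₀ ℕ}
    (h : MvPowerSeries.coeff m ((∏ i, xVar (u i) (v i)) * G) ≠ 0) (i : Fin k) :
    Var.X (u i) (v i) ∈ m.support := by
  rw [Finsupp.mem_support_iff]
  intro h0
  have hd : (MvPowerSeries.X (Var.X (u i) (v i)) : Ser) ∣ (∏ i, xVar (u i) (v i)) * G :=
    Dvd.dvd.mul_right (Finset.dvd_prod_of_mem (fun i => xVar (u i) (v i)) (Finset.mem_univ i)) G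
  exact h (MvPowerSeries.X_dvd_iff.mp hd m h0)

/-- Only finitely many tuples of indices occur in a given monomial. -/
theorem finite_tuples (k : ℕ) (m : Var →₀ ℕ) :
    {q : (Fin k → ℕ+) × (Fin k → ℕ+) | ∀ i, Var.X (q.1 i) (q.2 i) ∈ m.support}.Finite := by
  have hinj : Function.Injective fun (q : (Fin k → ℕ+) × (Fin k → ℕ+)) (i : Fin k) =>
      Var.X (q.1 i) (q.2 i) := by
    intro q r h
    have h' := fun i => Var.X.inj (congrFun h i)
    exact Prod.ext (funext fun i => (h' i).1) (funext fun i => (h' i).2)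
  refine Set.Finite.subset (Set.Finite.preimage hinj.injOn
    (Set.Finite.pi (t := fun _ : Fin k => (m.support : Set Var)) fun _ => m.support.finite_toSet)) ?_
  intro q hq
  simpa [Set.mem_pi] using hq

theorem locallyFinite_p (k : ℕ) :
    LocallyFinite fun a : Fin k → ℕ+ => cyclicMonomial a := by
  intro m
  have hinj : Function.Injective fun (a : Fin k → ℕ+) =>
      ((a, fun i => a (finRotate k i)) : (Fin k → ℕ+) × (Fin k → ℕ+)) :=
    fun a b h => congrArg Prod.fst h
  refine ((finite_tuples k m).preimage hinj.injOn).subset ?_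
  intro a ha i
  refine ne_zero_of_coeff (G := 1) ?_ i
  simpa [cyclicMonomial] using ha

theorem locallyFinite_W (d : ℕ) (F : Ser) :
    LocallyFinite fun q : (Fin d → ℕ+) × (Fin d → ℕ+) =>
      normalOrderedTerm q.1 (fun i => q.1 (finRotate d i)) q.2 F := by
  intro m
  refine (finite_tuples d m).subset ?_
  intro q hq i
  exact ne_zero_of_coeff hq i

/-- All monomials of `F` have total degree `n`. -/
def HomDeg (n : ℕ) (F : Ser) : Prop :=
  ∀ m : Var →₀ ℕ, MvPowerSeries.coeff m F ≠ 0 → m.degree = n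

theorem HomDeg.mul {n k : ℕ} {F G : Ser} (hF : HomDeg n F) (hG : HomDeg k G) :
    HomDeg (n + k) (F * G) := by
  classical
  intro m hm
  rw [MvPowerSeries.coeff_mul] at hm
  obtain ⟨q, hq, hne⟩ := Finset.exists_ne_zero_of_sum_ne_zero hm
  rw [← Finset.HasAntidiagonal.mem_antidiagonal.mp hq, map_add, hF _ (left_ne_zero_of_mul hne),
    hG _ (right_ne_zero_of_mul hne)]

theorem HomDeg.one : HomDeg 0 1 := by
  classical
  intro m hm
  rw [MvPowerSeries.coeff_one] at hm
  have : m = 0 := by by_contra h; simp [h] at hm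
  simp [this]

theorem HomDeg.var (s : Var) : HomDeg 1 (MvPowerSeries.X s) := by
  classical
  intro m hm
  rw [MvPowerSeries.coeff_X] at hm
  have : m = Finsupp.single s 1 := by by_contra h; simp [h] at hm
  simp [this]

theorem HomDeg.p (k : ℕ) : HomDeg k (p k) := by
  intro m hm
  have hm' : (∑ᶠ a : Fin k → ℕ+, MvPowerSeries.coeff m (cyclicMonomial a)) ≠ 0 := hm
  obtain ⟨a, ha⟩ : ∃ a : Fin k → ℕ+, MvPowerSeries.coeff m (cyclicMonomial a) ≠ 0 := by
    by_contra! h0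
    exact hm' (finsum_eq_zero_of_forall_eq_zero h0)
  have key : ∀ s : Finset (Fin k),
      HomDeg s.card (∏ i ∈ s, xVar (a i) (a (finRotate k i))) := by
    classical
    intro s
    induction s using Finset.induction_on with
    | empty => simpa using HomDeg.one
    | insert i s hi ih =>
      rw [Finset.prod_insert hi, Finset.card_insert_of_notMem hi, add_comm]
      exact (HomDeg.var _).mul ih
  simpa using key Finset.univ m ha

theorem HomDeg.pPart {n : ℕ} (α : n.Partition) : HomDeg n (pPart α) := by
  have key : ∀ s : Multiset ℕ, HomDeg s.sum (s.map WOp.p).prod := by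
    intro s
    induction s using Multiset.induction_on with
    | empty => simpa using HomDeg.one
    | cons k s ih => simpa using (HomDeg.p k).mul ih
  have h := key α.parts
  rw [α.parts_sum] at h
  exact h

theorem HomDeg.hTerm (d : ℕ) (q : ℕ+ × ℕ) : HomDeg (q.2 + (q.1 : ℕ)) (hTerm d q) := by
  intro m hm
  rw [WOp.hTerm, map_sum] at hm
  obtain ⟨α, -, hα⟩ := Finset.exists_ne_zero_of_sum_ne_zero hm
  have hz : ∀ k : ℕ, HomDeg k (zVar ^ k) := by
    intro k
    induction k with
    | zero => simpa using HomDeg.one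
    | succ k ih => rw [pow_succ]; exact ih.mul (HomDeg.var _)
  refine ((hz q.2).mul (HomDeg.pPart α)) m ?_
  rw [MvPowerSeries.coeff_smul] at hα
  exact right_ne_zero_of_mul hα

theorem locallyFinite_hTerm (d : ℕ) : LocallyFinite (hTerm d) := by
  intro m
  have hinj : Function.Injective fun q : ℕ+ × ℕ => ((q.1 : ℕ), q.2) := by
    intro q r h
    have h' := Prod.mk.inj h
    exact Prod.ext (PNat.coe_injective h'.1) h'.2
  refine (((Set.finite_Iic (m.degree, m.degree))).preimage hinj.injOn).subset ?_
  intro q hq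
  have h := HomDeg.hTerm d q m hq
  simp only [Set.mem_preimage, Set.mem_Iic, Prod.mk_le_mk]
  omega

theorem hasSubst_H (d : ℕ) : PowerSeries.HasSubst (H d) := by
  refine PowerSeries.HasSubst.of_constantCoeff_zero ?_
  by_contra hne
  have hm : (∑ᶠ q, MvPowerSeries.coeff 0 (hTerm d q)) ≠ 0 := hne
  obtain ⟨q, hq⟩ : ∃ q, MvPowerSeries.coeff 0 (WOp.hTerm d q) ≠ 0 := by
    by_contra! h0
    exact hm (finsum_eq_zero_of_forall_eq_zero h0)
  have h := HomDeg.hTerm d q 0 hq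
  have := q.1.pos
  simp only [map_zero] at h
  omega

theorem hasSubst_p_one : PowerSeries.HasSubst (p 1) := by
  refine PowerSeries.HasSubst.of_constantCoeff_zero ?_
  by_contra hne
  have h := HomDeg.p 1 0 hne
  simp at h

end WOp

namespace WOp

open MvPowerSeries
open Finset.HasAntidiagonal (antidiagonal mem_antidiagonal)

/-! ### Formal sums -/

/-! To a permutation σ of a finite set V belongs the sum over labellings `permSum σ` = ∑_a ∏_v
X_{a(v) a(σ v)}, which is the product of power sums given by the cycle type of σ (`permSum_eq`). The
d derivatives in `W d` remove from such a product the factors at d distinct points, listed by an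
embedding f of `Fin d` in V; the d new factors complete what is left to the product of σ composed
with the cycle `cyc f`. Hence `W d` acts on power sums as multiplication of σ by (1/d) ∑_f `cyc f`
(`W_permSum`), which for d ≥ 2 is the sum of all d-cycles.

Therefore the series of all words of embeddings, with weight z^k / (n! k! d^k) for length k on n
points, solves the equation: ∂/∂z lowers the exponent of z, `W d` adds a letter. At z = 0 only empty
words remain, and they sum to e^{p_1}.

This series is e^H. Splitting a word at the component of a marked point gives the recursion
`allSum_succ`, which is the exponential formula after an Euler operator is applied
(`allSeries_eq_exp`). The connected words give H (`H_eq_connSeries`): each d-cycle comes from d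
embeddings, and the last permutation of a Hurwitz tuple is forced by the others. Working with
embeddings also covers d = 1, where the letters on n points all give the identity: on two or more
points no word is then connected, and no tuple of identities is transitive.

Uniqueness holds because `W d` preserves the degree in z, so the coefficients at z^k determine those
at z^{k+1}. -/

theorem coeff_formalSum {ι : Type} (f : ι → Ser) (m : Var →₀ ℕ) :
    coeff m (formalSum f) = ∑ᶠ i, coeff m (f i) := rfl

theorem formalSum_add {ι : Type} {f g : ι → Ser} (hf : LocallyFinite f) (hg : LocallyFinite g) :
    formalSum (fun i => f i + g i) = formalSum f + formalSum g := by
  ext m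
  simp only [coeff_formalSum, map_add]
  exact finsum_add_distrib (hf m) (hg m)

theorem formalSum_smul {ι : Type} (c : ℂ) (f : ι → Ser) :
    formalSum (fun i => c • f i) = c • formalSum f := by
  ext m
  simp only [coeff_formalSum, MvPowerSeries.coeff_smul]
  rcases eq_or_ne c 0 with rfl | hc
  · simp
  · exact (smul_finsum c fun i => coeff m (f i)).symm

theorem formalSum_comp_equiv {ι κ : Type} (e : ι ≃ κ) (f : κ → Ser) :
    formalSum (fun i => f (e i)) = formalSum f := by
  ext m
  exact finsum_comp_equiv e (f := fun i => coeff m (f i))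

theorem LocallyFinite.mul {ι κ : Type} {f : ι → Ser} {g : κ → Ser} (hf : LocallyFinite f)
    (hg : LocallyFinite g) : LocallyFinite fun q : ι × κ => f q.1 * g q.2 := by
  classical
  intro m
  refine (Set.Finite.biUnion (Finset.HasAntidiagonal.antidiagonal m).finite_toSet
    fun x _ => (hf x.1).prod (hg x.2)).subset ?_
  intro q hq
  rw [Set.mem_ofPred_eq, coeff_mul] at hq
  obtain ⟨x, hx, hne⟩ := Finset.exists_ne_zero_of_sum_ne_zero hq
  exact Set.mem_biUnion hx ⟨left_ne_zero_of_mul hne, right_ne_zero_of_mul hne⟩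

theorem finsum_prod_mul {ι κ : Type} {u : ι → ℂ} {v : κ → ℂ} (hu : {i | u i ≠ 0}.Finite)
    (hv : {i | v i ≠ 0}.Finite) :
    ∑ᶠ q : ι × κ, u q.1 * v q.2 = (∑ᶠ i, u i) * ∑ᶠ j, v j := by
  rw [finsum_eq_sum_of_support_subset (s := hu.toFinset) u (by simp [Function.support]),
    finsum_eq_sum_of_support_subset (s := hv.toFinset) v (by simp [Function.support]),
    finsum_eq_sum_of_support_subset (s := hu.toFinset ×ˢ hv.toFinset), Finset.sum_product,
    Finset.sum_mul_sum]
  intro q hq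
  simpa using hq

theorem formalSum_mul {ι κ : Type} {f : ι → Ser} {g : κ → Ser} (hf : LocallyFinite f)
    (hg : LocallyFinite g) :
    formalSum (fun q : ι × κ => f q.1 * g q.2) = formalSum f * formalSum g := by
  classical
  ext m
  simp only [coeff_formalSum, coeff_mul]
  rw [finsum_sum_comm]
  · exact Finset.sum_congr rfl fun x _ => finsum_prod_mul (hf x.1) (hg x.2)
  · intro x _
    refine ((hf x.1).prod (hg x.2)).subset fun q hq => ?_
    exact ⟨left_ne_zero_of_mul hq, right_ne_zero_of_mul hq⟩

theorem formalSum_sum {ι κ : Type} (s : Finset κ) {f : κ → ι → Ser}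
    (hf : ∀ j ∈ s, LocallyFinite (f j)) :
    formalSum (fun i => ∑ j ∈ s, f j i) = ∑ j ∈ s, formalSum (f j) := by
  ext m
  simp only [coeff_formalSum, map_sum]
  exact finsum_sum_comm s _ fun j hj => hf j hj m

/-- Two nested formal sums in which the outer index is determined by the inner one. -/
theorem formalSum_formalSum_ite {ι κ : Type} [DecidableEq κ] (Q : ι → κ) {f : ι → Ser}
    (hf : LocallyFinite f) :
    formalSum (fun q : κ => formalSum fun i => if q = Q i then f i else 0) = formalSum f := by
  ext m
  simp only [coeff_formalSum]
  have hs : ∀ q, ∑ᶠ i, coeff m (if q = Q i then f i else 0) =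
      ∑ i ∈ (hf m).toFinset, if q = Q i then coeff m (f i) else 0 := by
    intro q
    rw [finsum_eq_sum_of_support_subset (s := (hf m).toFinset)]
    · exact Finset.sum_congr rfl fun i _ => by split_ifs <;> simp
    · intro i hi
      simp only [Set.Finite.coe_toFinset, Set.mem_ofPred_eq]
      intro h0
      apply hi
      dsimp only
      split_ifs <;> simp [h0]
  simp only [hs]
  rw [finsum_sum_comm, finsum_eq_sum_of_support_subset (s := (hf m).toFinset)]
  · refine Finset.sum_congr rfl fun i _ => ?_
    rw [finsum_eq_single _ (Q i) fun q hq => if_neg hq, if_pos rfl]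
  · intro i hi
    simpa using hi
  · intro i _
    exact (Set.finite_singleton (Q i)).subset fun q hq => by
      by_contra hne
      exact hq (if_neg hne)

/-- Linear operators that commute with formal sums. -/
def Cts (T : Module.End ℂ Ser) : Prop :=
  ∀ (ι : Type) (f : ι → Ser), LocallyFinite f →
    LocallyFinite (fun i => T (f i)) ∧ T (formalSum f) = formalSum fun i => T (f i)

theorem Cts.one : Cts 1 := fun _ _ hf => ⟨hf, rfl⟩

theorem Cts.mul {S T : Module.End ℂ Ser} (hS : Cts S) (hT : Cts T) : Cts (S * T) := by
  intro ι f hf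
  obtain ⟨h1, h2⟩ := hT ι f hf
  obtain ⟨h3, h4⟩ := hS ι _ h1
  exact ⟨h3, by rw [Module.End.mul_apply, h2, h4]; rfl⟩

theorem Cts.list_prod {L : List (Module.End ℂ Ser)} (hL : ∀ T ∈ L, Cts T) : Cts L.prod := by
  induction L with
  | nil => exact Cts.one
  | cons T L ih =>
    rw [List.prod_cons]
    exact (hL T (by simp)).mul (ih fun S hS => hL S (by simp [hS]))

theorem Cts.pderiv (s : Var) :
    Cts ((MvPowerSeries.pderiv ℂ s : Derivation ℂ Ser Ser) : Module.End ℂ Ser) := by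
  intro ι f hf
  constructor
  · intro m
    refine (hf (m + Finsupp.single s 1)).subset fun i hi => ?_
    have hi' : coeff m (MvPowerSeries.pderiv ℂ s (f i)) ≠ 0 := hi
    rw [coeff_pderiv] at hi'
    exact left_ne_zero_of_mul hi'
  · ext m
    change coeff m (MvPowerSeries.pderiv ℂ s (formalSum f)) =
      ∑ᶠ i, coeff m (MvPowerSeries.pderiv ℂ s (f i))
    simp only [coeff_pderiv, coeff_formalSum]
    exact finsum_mul' _ _ (hf _)

/-- The factor `G` is the sum of a family indexed by `Unit`, so this is a case of `formalSum_mul`.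
-/
theorem Cts.mulLeft (G : Ser) : Cts (LinearMap.mulLeft ℂ G) := by
  intro ι f hf
  have hG : LocallyFinite fun _ : Unit => G := fun m => Set.toFinite _
  have hsum : formalSum (fun _ : Unit => G) = G := by
    ext m
    rw [coeff_formalSum, finsum_eq_single _ () (by simp)]
  constructor
  · intro m
    refine ((hG.mul hf m).image Prod.snd).subset fun i hi => ⟨((), i), hi, rfl⟩
  · have h := formalSum_mul hG hf
    rw [hsum] at h
    rw [LinearMap.mulLeft_apply, ← h, ← formalSum_comp_equiv (Equiv.punitProd ι).symm]
    rfl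

/-! ### The summands of `W` -/

/-- `normalOrderedTerm` as a linear operator. -/
noncomputable def termOp {d : ℕ} (a b e : Fin d → ℕ+) : Module.End ℂ Ser :=
  LinearMap.mulLeft ℂ (∏ i, xVar (a i) (e i)) *
    (List.ofFn fun i => ((MvPowerSeries.pderiv ℂ (Var.X (b i) (e i)) : Derivation ℂ Ser Ser) :
      Module.End ℂ Ser)).prod

theorem termOp_apply {d : ℕ} (a b e : Fin d → ℕ+) (F : Ser) :
    normalOrderedTerm a b e F = termOp a b e F := rfl

theorem Cts.termOp {d : ℕ} (a b e : Fin d → ℕ+) : Cts (termOp a b e) := by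
  refine (Cts.mulLeft _).mul (Cts.list_prod fun T hT => ?_)
  obtain ⟨i, rfl⟩ := List.mem_ofFn.mp hT
  exact Cts.pderiv _

theorem W_add (d : ℕ) (F G : Ser) : W d (F + G) = W d F + W d G := by
  rw [W, W, W, ← smul_add, ← formalSum_add (locallyFinite_W d F) (locallyFinite_W d G)]
  simp only [termOp_apply, map_add]

theorem W_smul (d : ℕ) (c : ℂ) (F : Ser) : W d (c • F) = c • W d F := by
  rw [W, W, smul_comm c, ← formalSum_smul c]
  simp only [termOp_apply, map_smul]

theorem W_zero (d : ℕ) : W d 0 = 0 := by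
  have h := W_smul d 0 0
  simpa using h

theorem W_sum (d : ℕ) {ι : Type} (s : Finset ι) (f : ι → Ser) :
    W d (∑ i ∈ s, f i) = ∑ i ∈ s, W d (f i) := by
  classical
  induction s using Finset.induction_on with
  | empty => simp [W_zero]
  | insert i s hi ih => rw [Finset.sum_insert hi, Finset.sum_insert hi, W_add, ih]

theorem W_sub (d : ℕ) (F G : Ser) : W d (F - G) = W d F - W d G := by
  have h := W_add d (F - G) G
  rw [sub_add_cancel] at h
  rw [h, add_sub_cancel_right]

/-- Powers of z are constants for derivatives in the matrix entries; this makes `W d` commute with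
multiplication by them. -/
theorem list_prod_pderiv_mul (L : List Var) (hL : ∀ s ∈ L, s ≠ Var.z) (k : ℕ) (F : Ser) :
    (L.map fun s => ((MvPowerSeries.pderiv ℂ s : Derivation ℂ Ser Ser) :
      Module.End ℂ Ser)).prod (zVar ^ k * F) =
    zVar ^ k * (L.map fun s => ((MvPowerSeries.pderiv ℂ s : Derivation ℂ Ser Ser) :
      Module.End ℂ Ser)).prod F := by
  induction L with
  | nil => simp
  | cons s L ih =>
    rw [List.map_cons, List.prod_cons, Module.End.mul_apply, Module.End.mul_apply,
      ih fun t ht => hL t (by simp [ht])]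
    have hz : MvPowerSeries.pderiv ℂ s (zVar ^ k) = 0 := by
      rw [MvPowerSeries.pderiv_pow, zVar, MvPowerSeries.pderiv_X_of_ne (hL s (by simp)).symm,
        mul_zero]
    change MvPowerSeries.pderiv ℂ s _ = _
    rw [Derivation.leibniz, hz, smul_zero, add_zero]
    rfl

theorem W_zVar_pow_mul (d k : ℕ) (F : Ser) : W d (zVar ^ k * F) = zVar ^ k * W d F := by
  have h := (Cts.mulLeft (zVar ^ k) _ _ (locallyFinite_W d F)).2
  rw [W, W, mul_smul_comm]
  simp only [LinearMap.mulLeft_apply] at h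
  rw [h]
  congr 2
  funext q
  have := list_prod_pderiv_mul
    (List.ofFn fun i => Var.X (q.1 (finRotate d i)) (q.2 i)) (by simp [List.mem_ofFn]) k F
  rw [List.map_ofFn] at this
  rw [normalOrderedTerm, normalOrderedTerm, mul_left_comm]
  exact congrArg _ this

/-! ### Power sums of permutations -/

theorem sumCongr_one_eq_extendDomain {V V' : Type} [Fintype V] [DecidableEq V] [DecidableEq V']
    (σ : Equiv.Perm V) :
    Equiv.Perm.sumCongr σ (1 : Equiv.Perm V') =
      σ.extendDomain (Equiv.ofInjective Sum.inl (Sum.inl_injective (α := V) (β := V'))) := by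
  ext x
  rcases x with v | v
  · exact (Equiv.Perm.extendDomain_apply_image σ
      (Equiv.ofInjective Sum.inl (Sum.inl_injective (α := V) (β := V'))) v).symm
  · rw [Equiv.Perm.extendDomain_apply_not_subtype _ _ (by simp)]
    simp

theorem one_sumCongr_eq_extendDomain {V V' : Type} [Fintype V'] [DecidableEq V] [DecidableEq V']
    (τ : Equiv.Perm V') :
    Equiv.Perm.sumCongr (1 : Equiv.Perm V) τ =
      τ.extendDomain (Equiv.ofInjective Sum.inr (Sum.inr_injective (α := V) (β := V'))) := by
  ext x
  rcases x with v | v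
  · rw [Equiv.Perm.extendDomain_apply_not_subtype _ _ (by simp)]
    simp
  · exact (Equiv.Perm.extendDomain_apply_image τ
      (Equiv.ofInjective Sum.inr (Sum.inr_injective (α := V) (β := V'))) v).symm

section PermSum

variable {V V' : Type} [Fintype V] [Fintype V']

/-- The monomial `∏_v X_{a(v) a(σ v)}`. -/
noncomputable def permMonomial (σ : Equiv.Perm V) (a : V → ℕ+) : Ser :=
  ∏ v, xVar (a v) (a (σ v))

/-- The sum of `∏_v X_{a(v) a(σ v)}` over all labellings `a` of the points. -/
noncomputable def permSum (σ : Equiv.Perm V) : Ser := formalSum (permMonomial σ)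

theorem locallyFinite_permMonomial (σ : Equiv.Perm V) : LocallyFinite (permMonomial σ) := by
  intro m
  have hinj : Function.Injective fun (a : V → ℕ+) (v : V) => Var.X (a v) (a (σ v)) := by
    intro a b h
    exact funext fun v => (Var.X.inj (congrFun h v)).1
  refine Set.Finite.subset (Set.Finite.preimage hinj.injOn
    (Set.Finite.pi (t := fun _ : V => (m.support : Set Var)) fun _ => m.support.finite_toSet)) ?_
  intro a ha
  simp only [Set.mem_preimage, Set.mem_pi, Finset.mem_coe, Finsupp.mem_support_iff]
  intro v _ h0
  have hd : (MvPowerSeries.X (Var.X (a v) (a (σ v))) : Ser) ∣ permMonomial σ a :=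
    Finset.dvd_prod_of_mem (fun v => xVar (a v) (a (σ v))) (Finset.mem_univ v)
  exact ha (MvPowerSeries.X_dvd_iff.mp hd m h0)

theorem permSum_permCongr (e : V ≃ V') (σ : Equiv.Perm V) :
    permSum (e.permCongr σ) = permSum σ := by
  rw [permSum, permSum, ← formalSum_comp_equiv (Equiv.arrowCongr e (Equiv.refl ℕ+))]
  congr 1
  funext a
  rw [permMonomial, permMonomial, ← e.prod_comp]
  simp [Equiv.permCongr_apply]

theorem permSum_conj (σ τ : Equiv.Perm V) : permSum (τ * σ * τ⁻¹) = permSum σ := by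
  rw [← permSum_permCongr τ σ]
  rfl

theorem permSum_mul_comm (σ τ : Equiv.Perm V) : permSum (σ * τ) = permSum (τ * σ) := by
  rw [← permSum_conj (σ * τ) τ]
  congr 1
  group

/-- A labelling of a disjoint union is a pair of labellings, and the monomial factors accordingly.
-/
theorem permSum_sumCongr (σ : Equiv.Perm V) (τ : Equiv.Perm V') :
    permSum (Equiv.Perm.sumCongr σ τ) = permSum σ * permSum τ := by
  rw [permSum, permSum, permSum,
    ← formalSum_mul (locallyFinite_permMonomial σ) (locallyFinite_permMonomial τ),
    ← formalSum_comp_equiv (Equiv.sumArrowEquivProdArrow V V' ℕ+)]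
  congr 1
  funext a
  simp [permMonomial, Fintype.prod_sum_type, Equiv.sumArrowEquivProdArrow]

variable [DecidableEq V] [DecidableEq V']

theorem cycleType_sumCongr (σ : Equiv.Perm V) (τ : Equiv.Perm V') :
    (Equiv.Perm.sumCongr σ τ).cycleType = σ.cycleType + τ.cycleType := by
  classical
  have hd : Equiv.Perm.Disjoint (Equiv.Perm.sumCongr σ (1 : Equiv.Perm V'))
      (Equiv.Perm.sumCongr (1 : Equiv.Perm V) τ) := by
    rintro (v | v)
    · right; simp
    · left; simp
  have hm : Equiv.Perm.sumCongr σ τ = Equiv.Perm.sumCongr σ (1 : Equiv.Perm V') *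
      Equiv.Perm.sumCongr (1 : Equiv.Perm V) τ := by
    rw [Equiv.Perm.sumCongr_mul, mul_one, one_mul]
  rw [hm, hd.cycleType_mul, sumCongr_one_eq_extendDomain, one_sumCongr_eq_extendDomain,
    Equiv.Perm.cycleType_extendDomain, Equiv.Perm.cycleType_extendDomain]

theorem parts_sumCongr (σ : Equiv.Perm V) (τ : Equiv.Perm V') :
    (Equiv.Perm.sumCongr σ τ).partition.parts = σ.partition.parts + τ.partition.parts := by
  simp only [Equiv.Perm.parts_partition, ← Equiv.Perm.sum_cycleType, cycleType_sumCongr,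
    Multiset.sum_add, Fintype.card_sum]
  have h1 := σ.sum_cycleType_le
  have h2 := τ.sum_cycleType_le
  -- The fixed points are counted by a truncated difference, which splits because each cycle type
  -- sums to at most the number of points.
  rw [show Fintype.card V + Fintype.card V' - (σ.cycleType.sum + τ.cycleType.sum) =
    (Fintype.card V - σ.cycleType.sum) + (Fintype.card V' - τ.cycleType.sum) by omega,
    Multiset.replicate_add]
  abel

theorem parts_permCongr (e : V ≃ V') (σ : Equiv.Perm V) :
    (e.permCongr σ).partition.parts = σ.partition.parts := by
  have hc : (e.permCongr σ).cycleType = σ.cycleType := by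
    -- With `e` regarded as a bijection onto the full subtype, `permCongr` becomes `extendDomain`.
    have h := Equiv.Perm.cycleType_extendDomain
      (e.trans (Equiv.subtypeUnivEquiv (p := fun _ : V' => True) fun _ => trivial).symm) (g := σ)
    rw [← h]
    congr 1
  rw [Equiv.Perm.parts_partition, Equiv.Perm.parts_partition, ← Equiv.Perm.sum_cycleType,
    ← Equiv.Perm.sum_cycleType, hc, Fintype.card_congr e]

theorem parts_finRotate {k : ℕ} (hk : 0 < k) : (finRotate k).partition.parts = {k} := by
  obtain rfl | h2 : k = 1 ∨ 2 ≤ k := by omega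
  · rw [Equiv.Perm.parts_partition, Subsingleton.elim (finRotate 1) 1]
    simp
  · rw [Equiv.Perm.parts_partition, ← Equiv.Perm.sum_cycleType,
      cycleType_finRotate_of_le h2]
    simp

/-- The model permutation is a disjoint union of rotations; the `permSum` of a rotation is `p k` by
definition. -/
theorem exists_perm_parts (s : Multiset ℕ) (hs : ∀ k ∈ s, 0 < k) :
    ∃ (n : ℕ) (σ : Equiv.Perm (Fin n)), σ.partition.parts = s ∧ permSum σ = (s.map p).prod := by
  induction s using Multiset.induction_on with
  | empty =>
    refine ⟨0, 1, by simp [Equiv.Perm.parts_partition], ?_⟩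
    ext m
    rw [permSum, coeff_formalSum, finsum_eq_single _ default fun a ha =>
      (ha (Subsingleton.elim _ _)).elim, permMonomial, Fintype.prod_empty, Multiset.map_zero,
      Multiset.prod_zero]
  | cons k s ih =>
    obtain ⟨n, σ, h1, h2⟩ := ih fun j hj => hs j (Multiset.mem_cons_of_mem hj)
    refine ⟨k + n, finSumFinEquiv.permCongr (Equiv.Perm.sumCongr (finRotate k) σ), ?_, ?_⟩
    · rw [parts_permCongr, parts_sumCongr, h1, parts_finRotate (hs k (Multiset.mem_cons_self k s)),
        Multiset.singleton_add]
    · rw [permSum_permCongr, permSum_sumCongr, h2, Multiset.map_cons, Multiset.prod_cons]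
      rfl

/-- After transport to `Fin n`, σ is conjugate to the model permutation with the same parts, and
`permSum` is a class function. -/
theorem permSum_eq (σ : Equiv.Perm V) : permSum σ = pPart σ.partition := by
  obtain ⟨n, τ, h1, h2⟩ := exists_perm_parts σ.partition.parts fun k hk => σ.partition.parts_pos hk
  have hn : n = Fintype.card V := by
    have h := congrArg Multiset.sum h1
    rw [τ.partition.parts_sum, σ.partition.parts_sum, Fintype.card_fin] at h
    exact h
  subst hn
  let e := Fintype.equivFin V
  have hc : IsConj (e.permCongr σ) τ := by
    rw [Equiv.Perm.partition_eq_of_isConj, Nat.Partition.ext_iff, parts_permCongr, h1]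
  obtain ⟨ρ, hρ⟩ := isConj_iff.mp hc
  rw [← permSum_permCongr e σ, ← permSum_conj _ ρ, hρ, h2]
  rfl

theorem permSum_one : permSum (1 : Equiv.Perm V) = p 1 ^ Fintype.card V := by
  rw [permSum_eq, pPart]
  simp [Equiv.Perm.parts_partition]

end PermSum

/-! ### Iterated derivatives of monomials -/

theorem pderiv_prod_X {V : Type} [DecidableEq V] [DecidableEq Var] (x : V → Var) (s : Finset V)
    (y : Var) :
    MvPowerSeries.pderiv ℂ y (∏ v ∈ s, (MvPowerSeries.X (x v) : Ser)) =
      ∑ v ∈ s, if x v = y then ∏ u ∈ s.erase v, (MvPowerSeries.X (x u) : Ser) else 0 := by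
  induction s using Finset.induction_on with
  | empty => simp
  | insert v s hv ih =>
    rw [Finset.prod_insert hv, Derivation.leibniz, ih, Finset.sum_insert hv,
      Finset.erase_insert hv, add_comm, smul_eq_mul, smul_eq_mul, Finset.mul_sum]
    congr 1
    · split_ifs with h
      · rw [h, MvPowerSeries.pderiv_X_self, mul_one]
      · rw [MvPowerSeries.pderiv_X_of_ne h, mul_zero]
    · refine Finset.sum_congr rfl fun u hu => ?_
      have huv : v ≠ u := fun h => hv (h ▸ hu)
      rw [mul_ite, mul_zero, Finset.erase_insert_of_ne huv,
        Finset.prod_insert fun h => hv (Finset.mem_of_mem_erase h)]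

section Derivative

variable {V : Type} [Fintype V] [DecidableEq V]

/-- By Leibniz each derivative removes one factor, and successive derivatives remove factors at
distinct points; so the terms are indexed by embeddings, `f i` being the point removed by the i-th
derivative. -/
theorem list_prod_pderiv_prod_X [DecidableEq Var] (x : V → Var) {d : ℕ} (y : Fin d → Var) :
    (List.ofFn fun i => ((MvPowerSeries.pderiv ℂ (y i) : Derivation ℂ Ser Ser) :
      Module.End ℂ Ser)).prod (∏ v, (MvPowerSeries.X (x v) : Ser)) =
    ∑ f : Fin d ↪ V, if ∀ i, x (f i) = y i then
      ∏ v ∈ (Finset.univ.map f)ᶜ, (MvPowerSeries.X (x v) : Ser) else 0 := by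
  induction d with
  | zero => simp
  | succ d ih =>
    -- The head of the list acts last: it removes a point outside the range of the embedding chosen
    -- by the tail.
    rw [List.ofFn_succ, List.prod_cons, Module.End.mul_apply, ih, map_sum,
      ← (Equiv.embeddingFinSucc d V).symm.sum_comp, Fintype.sum_sigma]
    refine Finset.sum_congr rfl fun f _ => ?_
    have hmem : ∀ v, v ∉ Set.range f ↔ v ∈ (Finset.univ.map f)ᶜ := by simp
    have hx : ∀ v : {v // v ∉ Set.range f},
        (∀ i, x ((Equiv.embeddingFinSucc d V).symm ⟨f, v⟩ i) = y i) ↔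
          x v = y 0 ∧ ∀ i : Fin d, x (f i) = y i.succ := by
      intro v
      rw [Equiv.coe_embeddingFinSucc_symm, Fin.forall_fin_succ]
      simp
    have hs : ∀ v : {v // v ∉ Set.range f},
        (Finset.univ.map ((Equiv.embeddingFinSucc d V).symm ⟨f, v⟩))ᶜ =
          ((Finset.univ.map f)ᶜ).erase v := by
      intro v
      ext u
      simp only [Finset.mem_compl, Finset.mem_map, Finset.mem_univ, true_and, Finset.mem_erase,
        Equiv.coe_embeddingFinSucc_symm, Fin.exists_fin_succ, Fin.cons_zero, Fin.cons_succ, not_or,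
        eq_comm]
    simp only [hx, hs]
    by_cases hf : ∀ i : Fin d, x (f i) = y i.succ
    · rw [if_pos hf]
      change MvPowerSeries.pderiv ℂ (y 0) _ = _
      rw [pderiv_prod_X]
      simp only [hf, implies_true, and_true]
      exact (Finset.sum_subtype _ (fun v => (hmem v).symm) fun v => if x v = y 0 then
        ∏ u ∈ ((Finset.univ.map f)ᶜ).erase v, (MvPowerSeries.X (x u) : Ser) else 0)
    · simp [hf]

end Derivative

/-! ### The action of `W` on power sums -/

/-- The cyclic permutation `f 0 ↦ f 1 ↦ ⋯ ↦ f 0`. -/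
noncomputable def cyc {V : Type} [DecidableEq V] {d : ℕ} (f : Fin d ↪ V) : Equiv.Perm V :=
  (finRotate d).viaFintypeEmbedding f

theorem cyc_apply {V : Type} [DecidableEq V] {d : ℕ} (f : Fin d ↪ V) (i : Fin d) :
    cyc f (f i) = f (finRotate d i) :=
  Equiv.Perm.viaFintypeEmbedding_apply_image _ _ _

theorem cyc_apply_of_notMem {V : Type} [DecidableEq V] {d : ℕ} (f : Fin d ↪ V) {v : V}
    (hv : v ∉ Set.range f) :
    cyc f v = v :=
  Equiv.Perm.viaFintypeEmbedding_apply_notMem_range _ _ hv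

section Action

variable {V : Type} [Fintype V] [DecidableEq V]

/-- The derivatives remove X_{a(f i) a(σ(f i))}, which forces the index tuples `q`. Reindexed by the
rotation, the new factors are X_{a(f i) a(σ(f(i+1)))}, the factors of `σ * cyc f` at the points `f
i`; elsewhere `cyc f` is the identity. -/
theorem normalOrderedTerm_permMonomial {d : ℕ} (σ : Equiv.Perm V) (a : V → ℕ+)
    (q : (Fin d → ℕ+) × (Fin d → ℕ+)) :
    normalOrderedTerm q.1 (fun i => q.1 (finRotate d i)) q.2 (permMonomial σ a) =
      ∑ f : Fin d ↪ V, if q = (fun i => a (f ((finRotate d).symm i)), fun i => a (σ (f i))) then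
        permMonomial (σ * (cyc f)) a else 0 := by
  classical
  rw [normalOrderedTerm]
  have h := list_prod_pderiv_prod_X (fun v : V => Var.X (a v) (a (σ v)))
    fun i : Fin d => Var.X (q.1 (finRotate d i)) (q.2 i)
  refine (congrArg _ h).trans ?_
  rw [Finset.mul_sum]
  refine Finset.sum_congr rfl fun f _ => ?_
  have hiff : (∀ i, Var.X (a (f i)) (a (σ (f i))) = Var.X (q.1 (finRotate d i)) (q.2 i)) ↔
      q = (fun i => a (f ((finRotate d).symm i)), fun i => a (σ (f i))) := by
    constructor
    · intro h
      refine Prod.ext (funext fun i => ?_) (funext fun i => (Var.X.inj (h i)).2.symm)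
      have := (Var.X.inj (h ((finRotate d).symm i))).1
      rw [Equiv.apply_symm_apply] at this
      exact this.symm
    · rintro rfl i
      dsimp only
      rw [Equiv.symm_apply_apply]
  simp only [hiff]
  split_ifs with hq
  · rw [permMonomial, ← Finset.prod_mul_prod_compl (Finset.univ.map f), Finset.prod_map]
    congr 1
    · subst hq
      rw [← Equiv.prod_comp (finRotate d)]
      refine Finset.prod_congr rfl fun i _ => ?_
      dsimp only
      rw [Equiv.symm_apply_apply, Equiv.Perm.mul_apply, cyc_apply]
    · refine Finset.prod_congr rfl fun v hv => ?_
      have : v ∉ Set.range f := by simpa using hv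
      rw [Equiv.Perm.mul_apply, cyc_apply_of_notMem f this]
      rfl
  · rw [mul_zero]

/-- For a given `f` the index tuple is a function of the labelling, so the outer sum over tuples
collapses and the full sum over labellings for `σ * cyc f` remains. The factors may be swapped since
`permSum` is a class function. -/
theorem W_permSum (d : ℕ) (σ : Equiv.Perm V) :
    W d (permSum σ) = ((1 : ℂ) / d) • ∑ f : Fin d ↪ V, permSum (cyc f * σ) := by
  classical
  rw [W]
  congr 1
  have h1 : ∀ q : (Fin d → ℕ+) × (Fin d → ℕ+),
      normalOrderedTerm q.1 (fun i => q.1 (finRotate d i)) q.2 (permSum σ) =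
      ∑ f : Fin d ↪ V, formalSum fun a => if q = (fun i => a (f ((finRotate d).symm i)),
        fun i => a (σ (f i))) then permMonomial (σ * (cyc f)) a else 0 := by
    intro q
    rw [termOp_apply, permSum, (Cts.termOp _ _ _ _ _ (locallyFinite_permMonomial σ)).2]
    simp only [← termOp_apply, normalOrderedTerm_permMonomial]
    refine formalSum_sum _ fun f _ => ?_
    intro m
    refine (locallyFinite_permMonomial (σ * cyc f) m).subset fun a ha => ?_
    by_contra h0
    apply ha
    have h0' : coeff m (permMonomial (σ * cyc f) a) = 0 := by simpa using h0
    dsimp only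
    split_ifs <;> simp [h0']
  simp only [h1]
  rw [formalSum_sum]
  · refine Finset.sum_congr rfl fun f _ => ?_
    rw [formalSum_formalSum_ite (fun a : V → ℕ+ => ((fun i => a (f ((finRotate d).symm i)),
        fun i => a (σ (f i))) : (Fin d → ℕ+) × (Fin d → ℕ+)))
      (locallyFinite_permMonomial (σ * cyc f)), permSum_mul_comm]
    rfl
  · intro f _ m
    refine ((locallyFinite_permMonomial (σ * cyc f) m).image
      (fun a : V → ℕ+ => ((fun i => a (f ((finRotate d).symm i)),
        fun i => a (σ (f i))) : (Fin d → ℕ+) × (Fin d → ℕ+)))).subset fun q hq => ?_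
    rw [Set.mem_ofPred_eq, coeff_formalSum] at hq
    obtain ⟨a, ha⟩ : ∃ a : V → ℕ+, coeff m (if q = (fun i => a (f ((finRotate d).symm i)),
        fun i => a (σ (f i))) then permMonomial (σ * (cyc f)) a else 0) ≠ 0 := by
      by_contra! h0
      exact hq (finsum_eq_zero_of_forall_eq_zero h0)
    split_ifs at ha with hqa
    · exact ⟨a, ha, hqa.symm⟩
    · simp at ha

end Action

/-! ### Sums over words -/

section WordSum

/-- The sum of `φ w` over all words `w` of length `k` in the alphabet `A`. -/
def wordSum {A M : Type} [Fintype A] [AddCommMonoid M] : ℕ → (List A → M) → M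
  | 0, φ => φ []
  | k + 1, φ => ∑ a, wordSum k fun w => φ (a :: w)

variable {A B M : Type} [Fintype A] [Fintype B] [AddCommMonoid M]

theorem wordSum_zero_fun (k : ℕ) : wordSum k (fun _ : List A => (0 : M)) = 0 := by
  induction k with
  | zero => rfl
  | succ k ih => simp [wordSum, ih]

theorem wordSum_sum {ι : Type} (s : Finset ι) (k : ℕ) (φ : ι → List A → M) :
    wordSum k (fun w => ∑ i ∈ s, φ i w) = ∑ i ∈ s, wordSum k (φ i) := by
  induction k generalizing φ with
  | zero => rfl
  | succ k ih =>
    simp only [wordSum, ih]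
    exact Finset.sum_comm

theorem wordSum_eq_sum (k : ℕ) (φ : List A → M) :
    wordSum k φ = ∑ F : Fin k → A, φ (List.ofFn F) := by
  induction k generalizing φ with
  | zero => simp [wordSum]
  | succ k ih =>
    rw [wordSum, ← (Fin.consEquiv fun _ => A).sum_comp, Fintype.sum_prod_type]
    refine Finset.sum_congr rfl fun a _ => ?_
    rw [ih]
    refine Finset.sum_congr rfl fun F _ => ?_
    simp [Fin.consEquiv, List.ofFn_succ]

/-- Change of alphabet along a map all of whose relevant fibres have the same size. -/
theorem wordSum_map [DecidableEq A] (g : B → A) (P : A → Prop) (c k : ℕ) (φ : List A → M)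
    (hc : ∀ a, P a → (Finset.univ.filter fun b => g b = a).card = c)
    (hφ : ∀ w, φ w ≠ 0 → ∀ a ∈ w, P a) :
    wordSum k (fun w => φ (w.map g)) = c ^ k • wordSum k φ := by
  induction k generalizing φ with
  | zero => simp [wordSum]
  | succ k ih =>
    have hψ : ∀ b, wordSum k (fun w => φ (g b :: w.map g)) =
        c ^ k • wordSum k (fun w => φ (g b :: w)) := fun b =>
      ih (fun w => φ (g b :: w)) fun w hw a ha => hφ _ hw a (List.mem_cons_of_mem _ ha)
    simp only [wordSum, List.map_cons, hψ]
    rw [← Finset.sum_fiberwise Finset.univ g, Finset.smul_sum]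
    refine Finset.sum_congr rfl fun a _ => ?_
    rw [Finset.sum_congr rfl fun b hb => by rw [(Finset.mem_filter.mp hb).2], Finset.sum_const]
    -- Outside `P` the fibre size is irrelevant, because `φ` vanishes on every word starting with
    -- `a`.
    by_cases ha : P a
    · rw [hc a ha, smul_smul, pow_succ']
    · have h0 : wordSum k (fun w => φ (a :: w)) = 0 := by
        have : (fun w => φ (a :: w)) = fun _ => 0 := by
          funext w
          by_contra hne
          exact ha (hφ _ hne a (by simp))
        rw [this, wordSum_zero_fun]
      rw [h0]
      simp

theorem wordSum_map_injective [DecidableEq A] {g : B → A} (hg : Function.Injective g) (k : ℕ)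
    (φ : List A → M) (hφ : ∀ w, φ w ≠ 0 → ∀ a ∈ w, a ∈ Set.range g) :
    wordSum k (fun w => φ (w.map g)) = wordSum k φ := by
  rw [wordSum_map g (· ∈ Set.range g) 1 k φ _ hφ, one_pow, one_smul]
  rintro a ⟨b, rfl⟩
  rw [Finset.card_eq_one]
  exact ⟨b, by ext x; simp [hg.eq_iff]⟩

end WordSum

/-- A word in the disjoint union of two alphabets is a shuffle of two words. -/
theorem wordSum_sum_mul {A B : Type} [Fintype A] [Fintype B] (k : ℕ) (φ : List A → Ser)
    (ψ : List B → Ser) :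
    wordSum k (fun w : List (A ⊕ B) =>
      φ (w.filterMap Sum.getLeft?) * ψ (w.filterMap Sum.getRight?)) =
    ∑ x ∈ antidiagonal k, k.choose x.1 • (wordSum x.1 φ * wordSum x.2 ψ) := by
  induction k generalizing φ ψ with
  | zero => simp [wordSum]
  | succ k ih =>
    -- The two terms of Pascal's rule correspond to the alphabet of the first letter.
    rw [Finset.sum_antidiagonal_choose_succ_nsmul fun i j => wordSum i φ * wordSum j ψ, wordSum,
      Fintype.sum_sum_type]
    simp only [List.filterMap_cons, Sum.getLeft?_inl, Sum.getRight?_inl, Sum.getLeft?_inr,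
      Sum.getRight?_inr]
    rw [add_comm]
    congr 1
    · have h : ∀ b, wordSum k (fun w : List (A ⊕ B) =>
          φ (w.filterMap Sum.getLeft?) * ψ (b :: w.filterMap Sum.getRight?)) = _ :=
        fun b => ih φ fun w => ψ (b :: w)
      simp only [h, wordSum]
      rw [Finset.sum_comm]
      refine Finset.sum_congr rfl fun x _ => ?_
      rw [Finset.mul_sum, Finset.smul_sum]
    · have h : ∀ a, wordSum k (fun w : List (A ⊕ B) =>
          φ (a :: w.filterMap Sum.getLeft?) * ψ (w.filterMap Sum.getRight?)) = _ :=
        fun a => ih (fun w => φ (a :: w)) ψ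
      simp only [h, wordSum]
      rw [Finset.sum_comm]
      refine Finset.sum_congr rfl fun x hx => ?_
      rw [Finset.sum_mul, Finset.smul_sum,
        Nat.choose_symm_of_eq_add (mem_antidiagonal.mp hx).symm]

theorem W_wordSum {A : Type} [Fintype A] (d k : ℕ) (φ : List A → Ser) :
    W d (wordSum k φ) = wordSum k fun w => W d (φ w) := by
  induction k generalizing φ with
  | zero => rfl
  | succ k ih => simp only [wordSum, W_sum, ih]

/-! ### Words of embeddings -/

section Words

variable {d : ℕ} {U V : Type}

/-- A set of points is closed under a word if every letter lies inside it or outside it. -/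
def Closed (w : List (Fin d ↪ V)) (S : Set V) : Prop :=
  ∀ f ∈ w, ∀ i j, f i ∈ S → f j ∈ S

/-- A word is connected if only the empty set and the whole set are closed under it. -/
def Conn (w : List (Fin d ↪ V)) : Prop :=
  ∀ S : Set V, S.Nonempty → Closed w S → S = Set.univ

/-- The connected component of a point. -/
def component (w : List (Fin d ↪ V)) (v : V) : Set V :=
  {x | ∀ S, Closed w S → v ∈ S → x ∈ S}

theorem mem_component (w : List (Fin d ↪ V)) (v : V) : v ∈ component w v := fun _ _ h => h

theorem closed_component (w : List (Fin d ↪ V)) (v : V) : Closed w (component w v) :=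
  fun f hf i j hi S hS hv => hS f hf i j (hi S hS hv)

variable [DecidableEq U] [DecidableEq V]

/-- A criterion for recognising the cycle of a letter pushed along `ι`, applied below to bijections
and to the inclusions of two complementary subtypes. -/
theorem cyc_trans (ι : U ↪ V) (f : Fin d ↪ U) (τ : Equiv.Perm V)
    (h1 : ∀ u, τ (ι u) = ι (cyc f u)) (h2 : ∀ x, x ∉ Set.range ι → τ x = x) :
    cyc (f.trans ι) = τ := by
  ext x
  by_cases hx : x ∈ Set.range (f.trans ι)
  · obtain ⟨i, rfl⟩ := hx
    rw [cyc_apply, Function.Embedding.trans_apply, Function.Embedding.trans_apply, h1, cyc_apply]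
  · rw [cyc_apply_of_notMem _ hx]
    by_cases hι : x ∈ Set.range ι
    · obtain ⟨u, rfl⟩ := hι
      rw [h1, cyc_apply_of_notMem]
      rintro ⟨i, rfl⟩
      exact hx ⟨i, rfl⟩
    · exact (h2 x hι).symm

/-- The product of the cycles given by the letters of a word. -/
noncomputable def wordPerm (w : List (Fin d ↪ V)) : Equiv.Perm V := (w.map cyc).prod

theorem wordPerm_cons (f : Fin d ↪ V) (w : List (Fin d ↪ V)) :
    wordPerm (f :: w) = cyc f * wordPerm w := by simp [wordPerm]

theorem wordPerm_map_equiv (e : U ≃ V) (w : List (Fin d ↪ U)) :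
    wordPerm (w.map fun f => f.trans e.toEmbedding) = e.permCongr (wordPerm w) := by
  induction w with
  | nil => ext x; simp [wordPerm]
  | cons f w ih =>
    rw [List.map_cons, wordPerm_cons, wordPerm_cons, ih,
      cyc_trans e.toEmbedding f (e.permCongr (cyc f)) (by simp) (by simp)]
    ext x
    simp

/-- Letters on complementary sets act on different blocks, so the way the two subwords are
interleaved does not affect the product. -/
theorem wordPerm_map_sum (p : V → Prop) [DecidablePred p]
    (w : List ((Fin d ↪ {x // p x}) ⊕ (Fin d ↪ {x // ¬p x}))) :
    wordPerm (w.map (Sum.elim (fun f => f.trans (Function.Embedding.subtype p))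
      fun f => f.trans (Function.Embedding.subtype fun x => ¬p x))) =
    (Equiv.sumCompl p).permCongr (Equiv.Perm.sumCongr (wordPerm (w.filterMap Sum.getLeft?))
      (wordPerm (w.filterMap Sum.getRight?))) := by
  induction w with
  | nil => ext x; simp [wordPerm]
  | cons f w ih =>
    rw [List.map_cons, wordPerm_cons, ih]
    rcases f with f | f
    · have h := cyc_trans (Function.Embedding.subtype p) f ((Equiv.sumCompl p).permCongr
        (Equiv.Perm.sumCongr (cyc f) 1)) (by simp [Equiv.permCongr_apply])
        (by intro x hx; simp at hx; simp [Equiv.permCongr_apply, hx])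
      simp only [Sum.elim_inl, List.filterMap_cons, Sum.getLeft?_inl, Sum.getRight?_inl,
        wordPerm_cons]
      rw [h, ← Equiv.permCongr_mul, Equiv.Perm.sumCongr_mul, one_mul]
    · have h := cyc_trans (Function.Embedding.subtype fun x => ¬p x) f
        ((Equiv.sumCompl p).permCongr (Equiv.Perm.sumCongr 1 (cyc f)))
        (by rintro ⟨u, hu⟩; simp [Equiv.permCongr_apply, hu])
        (by intro x hx; simp at hx; simp [Equiv.permCongr_apply, hx])
      simp only [Sum.elim_inr, List.filterMap_cons, Sum.getLeft?_inr, Sum.getRight?_inr,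
        wordPerm_cons]
      rw [h, ← Equiv.permCongr_mul, Equiv.Perm.sumCongr_mul, one_mul]

end Words

/-! ### Splitting a word along the component of a point -/

section Components

variable {d : ℕ} {U V : Type}

theorem conn_map_equiv (e : U ≃ V) (w : List (Fin d ↪ U)) :
    Conn (w.map fun f => f.trans e.toEmbedding) ↔ Conn w := by
  constructor
  · intro h S ⟨s, hs⟩ hc
    have hS : e.symm ⁻¹' S = Set.univ := by
      refine h _ ⟨e s, by simpa using hs⟩ ?_
      intro f hf i j hi
      obtain ⟨f, hfw, rfl⟩ := List.mem_map.mp hf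
      simp only [Function.Embedding.trans_apply, Equiv.coe_toEmbedding, Set.mem_preimage,
        Equiv.symm_apply_apply] at hi ⊢
      exact hc f hfw i j hi
    ext u
    have : e u ∈ e.symm ⁻¹' S := hS ▸ Set.mem_univ _
    simpa using this
  · intro h S ⟨s, hs⟩ hc
    have hS : e ⁻¹' S = Set.univ := by
      refine h _ ⟨e.symm s, by simpa using hs⟩ ?_
      intro f hf i j hi
      exact hc _ (List.mem_map_of_mem hf) i j hi
    ext u
    have : e.symm u ∈ e ⁻¹' S := hS ▸ Set.mem_univ _
    simpa using this

/-- The component of `v` is `p` if and only if the word splits along `p` with connected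
left part. -/
theorem component_map_sum (p : V → Prop) (v : V) (hv : p v)
    (w : List ((Fin d ↪ {x // p x}) ⊕ (Fin d ↪ {x // ¬p x}))) :
    component (w.map (Sum.elim (fun f => f.trans (Function.Embedding.subtype p))
      fun f => f.trans (Function.Embedding.subtype fun x => ¬p x))) v = {x | p x} ↔
    Conn (w.filterMap Sum.getLeft?) := by
  set g : (Fin d ↪ {x // p x}) ⊕ (Fin d ↪ {x // ¬p x}) → (Fin d ↪ V) :=
    Sum.elim (fun f => f.trans (Function.Embedding.subtype p))
      fun f => f.trans (Function.Embedding.subtype fun x => ¬p x) with hg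
  have hleft : ∀ f, Sum.inl f ∈ w → f ∈ w.filterMap Sum.getLeft? := fun f hf =>
    List.mem_filterMap.mpr ⟨_, hf, rfl⟩
  have hpc : Closed (w.map g) {x | p x} := by
    intro f hf i j hi
    obtain ⟨f, hfw, rfl⟩ := List.mem_map.mp hf
    rcases f with f | f
    · exact (f j).2
    · exact absurd hi (f i).2
  have himg : ∀ T : Set {x // p x}, Closed (w.filterMap Sum.getLeft?) T →
      Closed (w.map g) (Subtype.val '' T) := by
    intro T hT f hf i j hi
    obtain ⟨f, hfw, rfl⟩ := List.mem_map.mp hf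
    obtain ⟨t, ht, hte⟩ := hi
    rcases f with f | f
    · have hti : t = f i := Subtype.ext hte
      exact ⟨f j, hT f (hleft f hfw) i j (hti ▸ ht), rfl⟩
    · have h1 : (t : V) = f i := hte
      exact absurd (h1 ▸ t.2) (f i).2
  constructor
  · intro hcomp T ⟨t, ht⟩ hT
    -- A closed set containing `v` has closed image in `V`, hence contains the whole component of
    -- `v`.
    have key : ∀ T' : Set {x // p x}, Closed (w.filterMap Sum.getLeft?) T' → ⟨v, hv⟩ ∈ T' →
        T' = Set.univ := by
      intro T' hT' hvT'
      ext x
      simp only [Set.mem_univ, iff_true]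
      have hx : (x : V) ∈ component (w.map g) v := hcomp ▸ x.2
      obtain ⟨y, hy, hyx⟩ := hx _ (himg T' hT') ⟨_, hvT', rfl⟩
      exact Subtype.ext hyx ▸ hy
    by_cases hvT : ⟨v, hv⟩ ∈ T
    · exact key T hT hvT
    -- Complements of closed sets are closed, so if `T` misses `v`, then `Tᶜ` is everything and `T`
    -- is empty.
    · have hc : Tᶜ = Set.univ := by
        refine key _ ?_ hvT
        intro f hf i j hi hj
        exact hi (hT f hf j i hj)
      exact absurd ht (show t ∈ Tᶜ from hc ▸ Set.mem_univ t)
  · intro hconn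
    refine Set.Subset.antisymm (fun x hx => hx _ hpc hv) fun x hx S hS hvS => ?_
    have : Subtype.val ⁻¹' S = (Set.univ : Set {x // p x}) := by
      refine hconn _ ⟨⟨v, hv⟩, hvS⟩ ?_
      intro f hf i j hi
      obtain ⟨f', hf', he⟩ := List.mem_filterMap.mp hf
      rcases f' with f' | f'
      · obtain rfl : f' = f := by simpa using he
        exact hS (g (Sum.inl f')) (List.mem_map_of_mem hf') i j hi
      · simp at he
    have hx' : (⟨x, hx⟩ : {x // p x}) ∈ Subtype.val ⁻¹' S := this ▸ Set.mem_univ _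
    exact hx'

end Components

theorem trans_injective {V V' : Type} (d : ℕ) (e : V ≃ V') :
    Function.Injective fun f : Fin d ↪ V => f.trans e.toEmbedding := by
  intro f g h
  ext i
  exact e.injective (DFunLike.congr_fun h i)

theorem trans_surjective {V V' : Type} (d : ℕ) (e : V ≃ V') :
    Function.Surjective fun f : Fin d ↪ V => f.trans e.toEmbedding := by
  intro f
  refine ⟨f.trans e.symm.toEmbedding, ?_⟩
  ext i
  simp

/-! ### Sums over all words and over connected words -/

section Sums

variable (d : ℕ) (V : Type) [Fintype V] [DecidableEq V]

/-- The sum of the power sums of all words of length `k`. -/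
noncomputable def allSum (k : ℕ) : Ser :=
  wordSum k fun w : List (Fin d ↪ V) => permSum (wordPerm w)

open scoped Classical in
/-- The sum of the power sums of all connected words of length `k`. -/
noncomputable def connSum (k : ℕ) : Ser :=
  wordSum k fun w : List (Fin d ↪ V) => if Conn w then permSum (wordPerm w) else 0

variable {V} {V' : Type} [Fintype V'] [DecidableEq V']

theorem allSum_congr (e : V ≃ V') (k : ℕ) : allSum d V k = allSum d V' k := by
  rw [allSum, allSum, ← wordSum_map_injective (trans_injective d e) k _
    fun _ _ a _ => trans_surjective d e a]
  simp only [wordPerm_map_equiv, permSum_permCongr]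

open scoped Classical in
theorem connSum_congr (e : V ≃ V') (k : ℕ) : connSum d V k = connSum d V' k := by
  rw [connSum, connSum, ← wordSum_map_injective (trans_injective d e) k _
    fun _ _ a _ => trans_surjective d e a]
  congr 1
  funext w
  rw [wordPerm_map_equiv, permSum_permCongr]
  exact if_congr (conn_map_equiv e w).symm rfl rfl

variable {d}

-- The words counted are the shuffles of a connected word on `S` with an arbitrary word on its
-- complement. Their permutations are block sums, on which `permSum` is multiplicative, and the
-- binomial coefficient counts the shuffles.
open scoped Classical in
theorem wordSum_component (hd : 1 ≤ d) (v : V) (S : Finset V) (hv : v ∈ S) (k : ℕ) :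
    wordSum k (fun w : List (Fin d ↪ V) =>
      if component w v = {x | x ∈ S} then permSum (wordPerm w) else 0) =
    ∑ x ∈ antidiagonal k, k.choose x.1 •
      (connSum d {x // x ∈ S} x.1 * allSum d {x // x ∉ S} x.2) := by
  set g : (Fin d ↪ {x // x ∈ S}) ⊕ (Fin d ↪ {x // x ∉ S}) → (Fin d ↪ V) :=
    Sum.elim (fun f => f.trans (Function.Embedding.subtype fun x => x ∈ S))
      fun f => f.trans (Function.Embedding.subtype fun x => x ∉ S) with hg
  -- As d ≥ 1, every letter has a point, which tells a letter on `S` from a letter on the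
  -- complement.
  let i0 : Fin d := ⟨0, hd⟩
  have hinj : Function.Injective g := by
    rintro (a | a) (b | b) h
    · congr 1
      ext i
      exact DFunLike.congr_fun h i
    · have h0 : ((a i0 : {x // x ∈ S}) : V) = b i0 := DFunLike.congr_fun h i0
      exact absurd (h0 ▸ (a i0).2) (b i0).2
    · have h0 : ((a i0 : {x // x ∉ S}) : V) = b i0 := DFunLike.congr_fun h i0
      exact absurd (h0.symm ▸ (b i0).2) (a i0).2
    · congr 1
      ext i
      exact DFunLike.congr_fun h i
  rw [← wordSum_map_injective hinj k _ ?_]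
  · refine Eq.trans ?_ (wordSum_sum_mul k (fun w : List (Fin d ↪ {x // x ∈ S}) =>
      if Conn w then permSum (wordPerm w) else 0) fun w : List (Fin d ↪ {x // x ∉ S}) =>
        permSum (wordPerm w))
    congr 1
    funext w
    rw [wordPerm_map_sum, permSum_permCongr, permSum_sumCongr, ite_mul, zero_mul]
    exact if_congr (component_map_sum (fun x => x ∈ S) v hv w) rfl rfl
  · intro w hw f hf
    have hcomp : component w v = {x | x ∈ S} := by
      by_contra h
      exact hw (if_neg h)
    have hcl : Closed w {x | x ∈ S} := hcomp ▸ closed_component w v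
    by_cases h0 : f i0 ∈ S
    · exact ⟨Sum.inl ⟨fun i => ⟨f i, hcl f hf i0 i h0⟩, fun i j h =>
        f.injective (congrArg Subtype.val h)⟩, rfl⟩
    · exact ⟨Sum.inr ⟨fun i => ⟨f i, fun hi => h0 (hcl f hf i i0 hi)⟩, fun i j h =>
        f.injective (congrArg Subtype.val h)⟩, rfl⟩

/-- Splitting off the component of a marked point. -/
theorem allSum_succ (hd : 1 ≤ d) (n k : ℕ) :
    allSum d (Fin (n + 1)) k = ∑ y ∈ antidiagonal n, n.choose y.1 •
      ∑ x ∈ antidiagonal k, k.choose x.1 •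
        (connSum d (Fin (y.1 + 1)) x.1 * allSum d (Fin y.2) x.2) := by
  classical
  let T : Finset (Fin (n + 1)) := Finset.univ.erase 0
  have hT : T.card = n := by simp [T]
  have hins : ∀ S ∈ T.powerset, (insert 0 S).card = S.card + 1 := by
    intro S hS
    exact Finset.card_insert_of_notMem fun h =>
      absurd (Finset.mem_powerset.mp hS h) (by simp [T])
  have hsplit : ∀ w : List (Fin d ↪ Fin (n + 1)), permSum (wordPerm w) =
      ∑ S ∈ T.powerset, if component w 0 = {x | x ∈ insert 0 S} then permSum (wordPerm w)
        else 0 := by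
    intro w
    have h0 : (0 : Fin (n + 1)) ∈ component w 0 := mem_component w 0
    -- Exactly one `S` contributes: the component of 0 with 0 removed.
    rw [Finset.sum_eq_single (T.filter fun x => x ∈ component w 0), if_pos]
    · ext x
      by_cases hx : x = 0
      · simp [hx, h0]
      · simp [hx, T]
    · intro S hS hne
      rw [if_neg]
      intro hc
      apply hne
      ext x
      have hx : x ∈ component w 0 ↔ x ∈ insert 0 S := by rw [hc]; rfl
      rw [Finset.mem_filter, hx]
      constructor
      · intro h
        exact (Finset.mem_powerset.mp hS h) |> fun hxT => ⟨hxT, Finset.mem_insert_of_mem h⟩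
      · rintro ⟨hxT, h⟩
        exact (Finset.mem_insert.mp h).resolve_left (Finset.ne_of_mem_erase hxT)
    · intro h
      exact absurd (Finset.mem_powerset.mpr (Finset.filter_subset _ _)) h
  rw [allSum, show (fun w : List (Fin d ↪ Fin (n + 1)) => permSum (wordPerm w)) = _ from
    funext hsplit, wordSum_sum]
  have hterm : ∀ S ∈ T.powerset, wordSum k (fun w : List (Fin d ↪ Fin (n + 1)) =>
      if component w 0 = {x | x ∈ insert 0 S} then permSum (wordPerm w) else 0) =
      (fun m => ∑ x ∈ antidiagonal k, k.choose x.1 •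
        (connSum d (Fin (m + 1)) x.1 * allSum d (Fin (n - m)) x.2)) S.card := by
    intro S hS
    rw [wordSum_component hd 0 (insert 0 S) (Finset.mem_insert_self 0 S)]
    refine Finset.sum_congr rfl fun x _ => ?_
    have hc := hins S hS
    rw [connSum_congr d (Fintype.equivFinOfCardEq (n := S.card + 1) (by
        rw [Fintype.card_coe, hc])),
      allSum_congr d (Fintype.equivFinOfCardEq (n := n - S.card) (by
        rw [Fintype.card_subtype_compl, Fintype.card_coe, hc, Fintype.card_fin]; omega))]
  rw [Finset.sum_congr rfl hterm]
  -- The summand depends only on the size of `S`, which produces the binomial coefficient in `n`.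
  refine (Finset.sum_powerset_apply_card (fun m => ∑ x ∈ antidiagonal k, k.choose x.1 •
    (connSum d (Fin (m + 1)) x.1 * allSum d (Fin (n - m)) x.2))).trans ?_
  rw [hT, Finset.Nat.sum_antidiagonal_eq_sum_range_succ_mk]

end Sums

/-! ### The bigrading by the degrees in the `X_{ab}` and in `z` -/

/-- The pair of the degree in the matrix entries and the degree in `z`. -/
noncomputable def bideg : (Var →₀ ℕ) →+ ℕ × ℕ :=
  Finsupp.weight fun s => match s with
    | Var.z => (0, 1)
    | Var.X _ _ => (1, 0)

theorem bideg_single_z : bideg (Finsupp.single Var.z 1) = (0, 1) := by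
  simp [bideg, Finsupp.weight_single]

theorem bideg_single_X (a b : ℕ+) : bideg (Finsupp.single (Var.X a b) 1) = (1, 0) := by
  simp [bideg, Finsupp.weight_single]

theorem bideg_snd (m : Var →₀ ℕ) : (bideg m).2 = m Var.z := by
  induction m using Finsupp.induction_linear with
  | zero => simp
  | add f g hf hg => simp [hf, hg]
  | single s n =>
    rw [bideg, Finsupp.weight_single]
    cases s <;> simp

theorem eq_zero_of_bideg (m : Var →₀ ℕ) (h : bideg m = 0) : m = 0 := by
  by_contra hne
  obtain ⟨s, hs⟩ := Finsupp.ne_iff.mp hne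
  have hle : Finsupp.single s 1 ≤ m := by
    rw [Finsupp.single_le_iff]
    exact Nat.one_le_iff_ne_zero.mpr hs
  obtain ⟨m', rfl⟩ := exists_add_of_le hle
  rw [map_add] at h
  cases s with
  | z =>
    rw [bideg_single_z] at h
    have := congrArg Prod.snd h
    simp at this
  | X a b =>
    rw [bideg_single_X] at h
    have := congrArg Prod.fst h
    simp at this

/-- All monomials of `F` have bidegree `x`. -/
def Hom (x : ℕ × ℕ) (F : Ser) : Prop := ∀ m, coeff m F ≠ 0 → bideg m = x

theorem Hom.zero (x : ℕ × ℕ) : Hom x 0 := fun _ h => absurd (map_zero _) h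

theorem Hom.smul {x : ℕ × ℕ} {F : Ser} (c : ℂ) (hF : Hom x F) : Hom x (c • F) := by
  intro m hm
  rw [MvPowerSeries.coeff_smul] at hm
  exact hF m (right_ne_zero_of_mul hm)

theorem Hom.sum {ι : Type} (s : Finset ι) {x : ℕ × ℕ} {f : ι → Ser}
    (hf : ∀ i ∈ s, Hom x (f i)) : Hom x (∑ i ∈ s, f i) := by
  intro m hm
  rw [map_sum] at hm
  obtain ⟨i, hi, hne⟩ := Finset.exists_ne_zero_of_sum_ne_zero hm
  exact hf i hi m hne

theorem Hom.mul {x y : ℕ × ℕ} {F G : Ser} (hF : Hom x F) (hG : Hom y G) : Hom (x + y) (F * G) := by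
  classical
  intro m hm
  rw [coeff_mul] at hm
  obtain ⟨q, hq, hne⟩ := Finset.exists_ne_zero_of_sum_ne_zero hm
  rw [← mem_antidiagonal.mp hq, map_add, hF _ (left_ne_zero_of_mul hne),
    hG _ (right_ne_zero_of_mul hne)]

theorem Hom.one : Hom 0 1 := by
  classical
  intro m hm
  rw [MvPowerSeries.coeff_one] at hm
  have : m = 0 := by by_contra h; simp [h] at hm
  simp [this]

theorem Hom.X (s : Var) : Hom (bideg (Finsupp.single s 1)) (MvPowerSeries.X s) := by
  classical
  intro m hm
  rw [MvPowerSeries.coeff_X] at hm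
  have : m = Finsupp.single s 1 := by by_contra h; simp [h] at hm
  rw [this]

theorem Hom.xVar (a b : ℕ+) : Hom (1, 0) (xVar a b) := bideg_single_X a b ▸ Hom.X (Var.X a b)

theorem Hom.zVar_pow (k : ℕ) : Hom (0, k) (zVar ^ k) := by
  induction k with
  | zero => exact Hom.one
  | succ k ih =>
    rw [pow_succ]
    exact ih.mul (bideg_single_z ▸ Hom.X Var.z)

theorem Hom.prod_xVar {ι : Type} [DecidableEq ι] (s : Finset ι) (a b : ι → ℕ+) :
    Hom (s.card, 0) (∏ i ∈ s, WOp.xVar (a i) (b i)) := by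
  induction s using Finset.induction_on with
  | empty => exact Hom.one
  | insert i s hi ih =>
    rw [Finset.prod_insert hi, Finset.card_insert_of_notMem hi, add_comm]
    exact (Hom.xVar _ _).mul ih

theorem Hom.permSum {V : Type} [Fintype V] (σ : Equiv.Perm V) :
    Hom (Fintype.card V, 0) (permSum σ) := by
  classical
  intro m hm
  obtain ⟨a, ha⟩ : ∃ a : V → ℕ+, coeff m (permMonomial σ a) ≠ 0 := by
    by_contra! h0
    exact hm (finsum_eq_zero_of_forall_eq_zero h0)
  exact Hom.prod_xVar Finset.univ a (fun v => a (σ v)) m ha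

theorem Hom.wordSum {A : Type} [Fintype A] {x : ℕ × ℕ} (k : ℕ) {φ : List A → Ser}
    (hφ : ∀ w, Hom x (φ w)) : Hom x (wordSum k φ) := by
  induction k generalizing φ with
  | zero => exact hφ []
  | succ k ih => exact Hom.sum _ fun a _ => ih fun w => hφ (a :: w)

theorem Hom.allSum (d : ℕ) (V : Type) [Fintype V] [DecidableEq V] (k : ℕ) :
    Hom (Fintype.card V, 0) (allSum d V k) :=
  Hom.wordSum k fun _ => Hom.permSum _

theorem Hom.connSum (d : ℕ) (V : Type) [Fintype V] [DecidableEq V] (k : ℕ) :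
    Hom (Fintype.card V, 0) (connSum d V k) := by
  refine Hom.wordSum k fun w => ?_
  split_ifs
  · exact Hom.permSum _
  · exact Hom.zero _

/-- The series whose component of bidegree `x` is that of `f x`. -/
noncomputable def gradedSum (f : ℕ × ℕ → Ser) : Ser := fun m => coeff m (f (bideg m))

theorem coeff_gradedSum (f : ℕ × ℕ → Ser) (m : Var →₀ ℕ) :
    coeff m (gradedSum f) = coeff m (f (bideg m)) := rfl

/-- By homogeneity, a pair of monomials meets only the one term of the double sum whose indices are
their bidegrees. -/
theorem gradedSum_mul {f g : ℕ × ℕ → Ser} (hf : ∀ x, Hom x (f x)) (hg : ∀ x, Hom x (g x)) :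
    gradedSum f * gradedSum g = gradedSum fun x => ∑ i ∈ antidiagonal x.1, ∑ j ∈ antidiagonal x.2,
      f (i.1, j.1) * g (i.2, j.2) := by
  classical
  ext m
  simp only [coeff_gradedSum, coeff_mul, map_sum]
  rw [Finset.sum_congr rfl fun i _ => Finset.sum_comm, Finset.sum_comm]
  refine Finset.sum_congr rfl fun q hq => ?_
  have hm := congrArg bideg (mem_antidiagonal.mp hq)
  rw [map_add] at hm
  have h1 := congrArg Prod.fst hm
  have h2 := congrArg Prod.snd hm
  have hz : ∀ i j : ℕ × ℕ, (i.1, j.1) ≠ bideg q.1 ∨ (i.2, j.2) ≠ bideg q.2 →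
      coeff q.1 (f (i.1, j.1)) * coeff q.2 (g (i.2, j.2)) = 0 := by
    intro i j h
    by_contra hne
    rcases h with h | h
    · exact h (hf _ _ (left_ne_zero_of_mul hne)).symm
    · exact h (hg _ _ (right_ne_zero_of_mul hne)).symm
  rw [Finset.sum_eq_single ((bideg q.1).1, (bideg q.2).1),
    Finset.sum_eq_single ((bideg q.1).2, (bideg q.2).2)]
  · intro j _ hj
    apply hz
    by_contra! hc
    exact hj (Prod.ext (congrArg Prod.snd hc.1 :) (congrArg Prod.snd hc.2 :))
  · intro h
    exact absurd (mem_antidiagonal.mpr h2) h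
  · intro i _ hi
    refine Finset.sum_eq_zero fun j _ => hz i j ?_
    by_contra! hc
    exact hi (Prod.ext (congrArg Prod.fst hc.1 :) (congrArg Prod.fst hc.2 :))
  · intro h
    exact absurd (mem_antidiagonal.mpr h1) h

/-! ### The differential equation -/

/-- Phrased through nonzero coefficients because uniqueness applies it to arbitrary, inhomogeneous
series. -/
theorem exists_coeff_of_list_prod_pderiv (L : List (ℕ+ × ℕ+)) (F : Ser) (m : Var →₀ ℕ)
    (h : coeff m ((L.map fun s => ((MvPowerSeries.pderiv ℂ (Var.X s.1 s.2) :
      Derivation ℂ Ser Ser) : Module.End ℂ Ser)).prod F) ≠ 0) :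
    ∃ m', bideg m' = (L.length, 0) + bideg m ∧ coeff m' F ≠ 0 := by
  induction L generalizing m with
  | nil => exact ⟨m, by simp, h⟩
  | cons s L ih =>
    rw [List.map_cons, List.prod_cons, Module.End.mul_apply] at h
    have h' : coeff m (MvPowerSeries.pderiv ℂ (Var.X s.1 s.2) _) ≠ 0 := h
    rw [coeff_pderiv] at h'
    obtain ⟨m', h1, h2⟩ := ih _ (left_ne_zero_of_mul h')
    refine ⟨m', ?_, h2⟩
    rw [h1, map_add, bideg_single_X, List.length_cons, add_comm (bideg m), ← add_assoc]
    rfl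

/-- `W([d])` preserves bidegrees. -/
theorem exists_coeff_of_coeff_W (d : ℕ) (F : Ser) (m : Var →₀ ℕ) (h : coeff m (W d F) ≠ 0) :
    ∃ m', bideg m' = bideg m ∧ coeff m' F ≠ 0 := by
  classical
  rw [W, MvPowerSeries.coeff_smul] at h
  obtain ⟨q, hq⟩ : ∃ q : (Fin d → ℕ+) × (Fin d → ℕ+),
      coeff m (normalOrderedTerm q.1 (fun i => q.1 (finRotate d i)) q.2 F) ≠ 0 := by
    by_contra! h0
    exact right_ne_zero_of_mul h (finsum_eq_zero_of_forall_eq_zero h0)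
  rw [normalOrderedTerm, coeff_mul] at hq
  obtain ⟨x, hx, hne⟩ := Finset.exists_ne_zero_of_sum_ne_zero hq
  have h1 := Hom.prod_xVar Finset.univ _ _ _ (left_ne_zero_of_mul hne)
  have h2 := right_ne_zero_of_mul hne
  have hL := exists_coeff_of_list_prod_pderiv
    (List.ofFn fun i => (q.1 (finRotate d i), q.2 i)) F x.2
  rw [List.map_ofFn] at hL
  obtain ⟨m', h3, h4⟩ := hL h2
  refine ⟨m', ?_, h4⟩
  rw [h3, ← mem_antidiagonal.mp hx, map_add, h1, List.length_ofFn, Finset.card_univ,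
    Fintype.card_fin]

/-- The difference of the two arguments has no term of the bidegree of `m`, and `W d` preserves
bidegrees. -/
theorem coeff_W_gradedSum (d : ℕ) (f : ℕ × ℕ → Ser) (m : Var →₀ ℕ) :
    coeff m (W d (gradedSum f)) = coeff m (W d (f (bideg m))) := by
  rw [← sub_eq_zero, ← map_sub, ← W_sub]
  by_contra hne
  obtain ⟨m', h1, h2⟩ := exists_coeff_of_coeff_W d _ m hne
  rw [map_sub, coeff_gradedSum, h1, sub_self] at h2
  exact h2 rfl

theorem coeff_dz (F : Ser) (m : Var →₀ ℕ) :
    coeff m (dz F) = coeff (m + Finsupp.single Var.z 1) F * (m Var.z + 1) := coeff_pderiv _ _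

theorem dz_eq_zero {n : ℕ} {F : Ser} (hF : Hom (n, 0) F) : dz F = 0 := by
  ext m
  rw [coeff_dz, map_zero]
  by_contra hne
  have h := hF _ (left_ne_zero_of_mul hne)
  rw [map_add, bideg_single_z] at h
  have := congrArg Prod.snd h
  simp at this

theorem dz_smul_zVar_pow_mul {n : ℕ} {F : Ser} (hF : Hom (n, 0) F) (c : ℂ) (k : ℕ) :
    dz (c • (zVar ^ (k + 1) * F)) = (c * (k + 1)) • (zVar ^ k * F) := by
  have h : MvPowerSeries.pderiv ℂ Var.z F = 0 := dz_eq_zero hF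
  have hz : MvPowerSeries.pderiv ℂ Var.z (zVar ^ (k + 1)) = ((k : ℂ) + 1) • zVar ^ k := by
    rw [MvPowerSeries.pderiv_pow, zVar, MvPowerSeries.pderiv_X_self, mul_one,
      Nat.add_sub_cancel, MvPowerSeries.smul_eq_C_mul]
    simp
  rw [dz, Derivation.map_smul, Derivation.leibniz, h, hz, smul_zero, zero_add, smul_eq_mul,
    mul_smul_comm, smul_smul, mul_comm F]

/-- A solution of the differential equation is determined by its value at `z = 0`. -/
theorem eq_of_dz_eq_W {d : ℕ} {F G : Ser} (hF : dz F = W d F) (hG : dz G = W d G)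
    (h0 : atZero F = atZero G) : F = G := by
  have hD : dz (F - G) = W d (F - G) := by
    rw [W_sub, ← hF, ← hG]
    exact map_sub (MvPowerSeries.pderiv ℂ Var.z) F G
  -- Induction on the degree in z: a coefficient at degree k + 1 is, up to a nonzero factor, one of
  -- `dz (F - G) = W d (F - G)` at degree k, which only sees coefficients of `F - G` at degree k.
  have key : ∀ k : ℕ, ∀ m : Var →₀ ℕ, m Var.z = k → coeff m (F - G) = 0 := by
    intro k
    induction k with
    | zero =>
      intro m hm
      have h := congrFun h0 m
      simp only [atZero, hm, if_true] at h
      rw [map_sub, h, sub_self]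
    | succ k ih =>
      intro m hm
      have hle : Finsupp.single Var.z 1 ≤ m := by
        rw [Finsupp.single_le_iff]
        omega
      obtain ⟨m', rfl⟩ := exists_add_of_le hle
      rw [add_comm] at hm ⊢
      have hm' : m' Var.z = k := by simpa using hm
      have hc := coeff_dz (F - G) m'
      rw [hD] at hc
      have hW : coeff m' (W d (F - G)) = 0 := by
        by_contra hne
        obtain ⟨m'', h1, h2⟩ := exists_coeff_of_coeff_W d _ m' hne
        refine h2 (ih m'' ?_)
        rw [← bideg_snd, h1, bideg_snd, hm']
      rw [hW] at hc
      exact (mul_eq_zero.mp hc.symm).resolve_right (Nat.cast_add_one_ne_zero _)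
  ext m
  have := key _ m rfl
  rwa [map_sub, sub_eq_zero] at this

/-- Multiplying on the left by `cyc f` and summing over `f` prepends a letter to every word. -/
theorem W_allSum (d : ℕ) (V : Type) [Fintype V] [DecidableEq V] (k : ℕ) :
    W d (allSum d V k) = ((1 : ℂ) / d) • allSum d V (k + 1) := by
  rw [allSum, W_wordSum, allSum, wordSum]
  simp only [W_permSum, wordPerm_cons]
  rw [← wordSum_sum]
  have hsmul : ∀ (c : ℂ) (φ : List (Fin d ↪ V) → Ser) (k : ℕ),
      wordSum k (fun w => c • φ w) = c • wordSum k φ := by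
    intro c φ k
    rw [wordSum_eq_sum, wordSum_eq_sum, Finset.smul_sum]
  exact hsmul _ _ k

/-- The normalization of the component of bidegree `(n, k)`. -/
noncomputable def normFactor (d : ℕ) (x : ℕ × ℕ) : ℂ :=
  1 / ((x.1.factorial : ℂ) * (x.2.factorial : ℂ) * (d : ℂ) ^ x.2)

/-- The components of the generating series of all words. -/
noncomputable def allTerm (d : ℕ) (x : ℕ × ℕ) : Ser :=
  normFactor d x • (zVar ^ x.2 * allSum d (Fin x.1) x.2)

/-- The components of the generating series of connected words. -/
noncomputable def connTerm (d : ℕ) (x : ℕ × ℕ) : Ser :=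
  normFactor d x • (zVar ^ x.2 * connSum d (Fin x.1) x.2)

theorem Hom.allTerm (d : ℕ) (x : ℕ × ℕ) : Hom x (allTerm d x) := by
  have h := ((Hom.zVar_pow x.2).mul (Hom.allSum d (Fin x.1) x.2)).smul (normFactor d x)
  simpa [WOp.allTerm] using h

theorem Hom.connTerm (d : ℕ) (x : ℕ × ℕ) : Hom x (connTerm d x) := by
  have h := ((Hom.zVar_pow x.2).mul (Hom.connSum d (Fin x.1) x.2)).smul (normFactor d x)
  simpa [WOp.connTerm] using h

theorem dz_allTerm {d : ℕ} (hd : 1 ≤ d) (n k : ℕ) :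
    dz (allTerm d (n, k + 1)) = W d (allTerm d (n, k)) := by
  have hd' : (d : ℂ) ≠ 0 := by exact_mod_cast (show d ≠ 0 by omega)
  rw [allTerm, allTerm, W_smul, W_zVar_pow_mul, W_allSum, mul_smul_comm, smul_smul,
    dz_smul_zVar_pow_mul (Hom.allSum d (Fin n) (k + 1))]
  congr 1
  have h1 : (n.factorial : ℂ) ≠ 0 := by exact_mod_cast n.factorial_ne_zero
  have h2 : (k.factorial : ℂ) ≠ 0 := by exact_mod_cast k.factorial_ne_zero
  have h3 : (k : ℂ) + 1 ≠ 0 := by exact_mod_cast k.succ_ne_zero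
  simp only [normFactor, Nat.factorial_succ, Nat.cast_mul, Nat.cast_add, Nat.cast_one, pow_succ]
  field_simp

theorem dz_allSeries {d : ℕ} (hd : 1 ≤ d) :
    dz (gradedSum (allTerm d)) = W d (gradedSum (allTerm d)) := by
  ext m
  rw [coeff_W_gradedSum, coeff_dz, coeff_gradedSum, map_add, bideg_single_z]
  have h : bideg m + (0, 1) = ((bideg m).1, (bideg m).2 + 1) := rfl
  rw [h, ← coeff_dz, dz_allTerm hd]

/-! ### Exponentials -/

/-- The Euler operator: multiplication by the degree in the matrix entries. -/
noncomputable def euler (F : Ser) : Ser := fun m => ((bideg m).1 : ℂ) * coeff m F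

theorem coeff_euler (F : Ser) (m : Var →₀ ℕ) :
    coeff m (euler F) = ((bideg m).1 : ℂ) * coeff m F := rfl

theorem euler_mul (F G : Ser) : euler (F * G) = euler F * G + F * euler G := by
  classical
  ext m
  rw [coeff_euler, map_add, coeff_mul, coeff_mul, coeff_mul, Finset.mul_sum,
    ← Finset.sum_add_distrib]
  refine Finset.sum_congr rfl fun q hq => ?_
  rw [coeff_euler, coeff_euler, ← mem_antidiagonal.mp hq, map_add, Prod.fst_add, Nat.cast_add]
  ring

theorem euler_pow_succ (F : Ser) (n : ℕ) :
    euler (F ^ (n + 1)) = ((n : ℂ) + 1) • (euler F * F ^ n) := by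
  induction n with
  | zero => simp
  | succ n ih =>
    rw [pow_succ, euler_mul, ih, smul_mul_assoc, mul_assoc, ← pow_succ, mul_comm _ (euler F),
      Nat.cast_add, Nat.cast_one, add_smul ((n : ℂ) + 1) (1 : ℂ), one_smul]

/-- The series has no term of degree zero in the matrix entries. -/
def NoConst (F : Ser) : Prop := ∀ m, (bideg m).1 = 0 → coeff m F = 0

theorem NoConst.euler {F : Ser} (hF : NoConst F) : NoConst (euler F) := by
  intro m hm
  rw [coeff_euler, hF m hm, mul_zero]

theorem NoConst.coeff_pow {F : Ser} (hF : NoConst F) (n : ℕ) (m : Var →₀ ℕ)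
    (hm : (bideg m).1 < n) : coeff m (F ^ n) = 0 := by
  classical
  induction n generalizing m with
  | zero => omega
  | succ n ih =>
    rw [pow_succ, coeff_mul]
    refine Finset.sum_eq_zero fun q hq => ?_
    have h := congrArg Prod.fst (congrArg bideg (mem_antidiagonal.mp hq))
    rw [map_add, Prod.fst_add] at h
    by_cases h2 : (bideg q.2).1 = 0
    · rw [hF _ h2, mul_zero]
    · rw [ih _ (by omega), zero_mul]

theorem NoConst.hasSubst {F : Ser} (hF : NoConst F) : PowerSeries.HasSubst F :=
  PowerSeries.HasSubst.of_constantCoeff_zero (hF 0 (by simp))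

/-- The power `F ^ n` starts in matrix degree n. The bound `N` is left free so that one cutoff can
serve all factors of a product. -/
theorem NoConst.coeff_expSeries {F : Ser} (hF : NoConst F) (m : Var →₀ ℕ) (N : ℕ)
    (hN : (bideg m).1 < N) :
    coeff m (expSeries F) = ∑ n ∈ Finset.range N, (1 / (n.factorial : ℂ)) * coeff m (F ^ n) := by
  rw [expSeries, PowerSeries.coeff_subst hF.hasSubst,
    finsum_eq_sum_of_support_subset (s := Finset.range N)]
  · refine Finset.sum_congr rfl fun n _ => ?_
    rw [PowerSeries.coeff_exp, smul_eq_mul]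
    simp
  · intro n hn
    rw [Finset.coe_range, Set.mem_Iio]
    by_contra hlt
    apply hn
    dsimp only
    rw [hF.coeff_pow n m (by omega), smul_zero]

theorem NoConst.euler_expSeries {F : Ser} (hF : NoConst F) :
    WOp.euler (expSeries F) = WOp.euler F * expSeries F := by
  classical
  ext m
  set N := (bideg m).1 with hN
  have hl : coeff m (WOp.euler (expSeries F)) = ∑ n ∈ Finset.range (N + 1),
      (1 / (n.factorial : ℂ)) * coeff m (WOp.euler F * F ^ n) := by
    -- The term of exponent zero dies under the Euler operator, so N + 2 terms leave, after the
    -- shift, the N + 1 terms used on the other side.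
    rw [coeff_euler, hF.coeff_expSeries m (N + 2) (by omega), Finset.sum_range_succ', pow_zero,
      mul_add, Finset.mul_sum]
    have h0 : ((bideg m).1 : ℂ) * (1 / (Nat.factorial 0 : ℂ) * coeff m (1 : Ser)) = 0 := by
      rw [MvPowerSeries.coeff_one]
      split_ifs with h
      · simp [h]
      · simp
    rw [h0, add_zero]
    refine Finset.sum_congr rfl fun n _ => ?_
    rw [mul_left_comm, ← coeff_euler, euler_pow_succ, MvPowerSeries.coeff_smul, ← mul_assoc]
    congr 1
    have h1 : (n.factorial : ℂ) ≠ 0 := by exact_mod_cast n.factorial_ne_zero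
    have h2 : (n : ℂ) + 1 ≠ 0 := Nat.cast_add_one_ne_zero n
    rw [Nat.factorial_succ, Nat.cast_mul, Nat.cast_add, Nat.cast_one]
    field_simp
  rw [hl, coeff_mul]
  simp only [coeff_mul, Finset.mul_sum]
  rw [Finset.sum_comm]
  refine Finset.sum_congr rfl fun q hq => ?_
  have h := congrArg Prod.fst (congrArg bideg (mem_antidiagonal.mp hq))
  rw [map_add, Prod.fst_add] at h
  rw [hF.coeff_expSeries q.2 (N + 1) (by omega), Finset.mul_sum]
  exact Finset.sum_congr rfl fun n _ => by ring

/-- As `K` has no term of matrix degree zero, n times a coefficient of `F` in degree n involves only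
coefficients of `F` in lower degrees. -/
theorem eq_of_euler_eq {F G K : Ser} (hK : NoConst K) (hF : euler F = K * F)
    (hG : euler G = K * G) (h0 : ∀ m, (bideg m).1 = 0 → coeff m F = coeff m G) : F = G := by
  classical
  have key : ∀ n : ℕ, ∀ m, (bideg m).1 = n → coeff m F = coeff m G := by
    intro n
    induction n using Nat.strong_induction_on with
    | _ n ih =>
      intro m hm
      rcases Nat.eq_zero_or_pos n with rfl | hn
      · exact h0 m hm
      have hn' : (n : ℂ) ≠ 0 := by exact_mod_cast hn.ne'
      apply mul_left_cancel₀ hn'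
      have e1 := coeff_euler F m
      have e2 := coeff_euler G m
      rw [hm] at e1 e2
      rw [← e1, ← e2, hF, hG, coeff_mul, coeff_mul]
      refine Finset.sum_congr rfl fun q hq => ?_
      have h := congrArg Prod.fst (congrArg bideg (mem_antidiagonal.mp hq))
      rw [map_add, Prod.fst_add] at h
      by_cases hq1 : (bideg q.1).1 = 0
      · rw [hK _ hq1, zero_mul, zero_mul]
      · rw [ih _ (by omega) q.2 rfl]
  ext m
  exact key _ m rfl

/-! ### The exponential formula -/

/-- The generating series of the connected words. -/
noncomputable def connSeries (d : ℕ) : Ser :=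
  gradedSum fun x => if x.1 = 0 then 0 else connTerm d x

theorem noConst_connSeries (d : ℕ) : NoConst (connSeries d) := by
  intro m hm
  rw [connSeries, coeff_gradedSum, if_pos hm, map_zero]

/-- `connSeries` omits the components with `x.1 = 0`, since the empty word on no points is vacuously
connected; the factor `x.1` kills them, so here they need no exception. -/
theorem euler_connSeries (d : ℕ) :
    euler (connSeries d) = gradedSum fun x => (x.1 : ℂ) • connTerm d x := by
  ext m
  rw [coeff_euler, connSeries, coeff_gradedSum, coeff_gradedSum, MvPowerSeries.coeff_smul]
  split_ifs with h
  · simp [h]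
  · rfl

/-- With n = i1 + i2 + 1, both n · C(n-1, i1) / n! and (i1+1) / ((i1+1)! i2!) equal 1 / (i1! i2!).
-/
theorem normFactor_mul {d : ℕ} (hd : 1 ≤ d) (i1 i2 j1 j2 : ℕ) :
    ((i1 + i2 + 1 : ℕ) : ℂ) * normFactor d (i1 + i2 + 1, j1 + j2) * ((i1 + i2).choose i1 : ℂ) *
      ((j1 + j2).choose j1 : ℂ) =
    normFactor d (i2, j2) * (((i1 + 1 : ℕ) : ℂ) * normFactor d (i1 + 1, j1)) := by
  have hd' : (d : ℂ) ≠ 0 := by exact_mod_cast (show d ≠ 0 by omega)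
  have key : ∀ a b : ℕ, ((a + b).factorial : ℂ) =
      ((a + b).choose a : ℂ) * a.factorial * b.factorial := by
    intro a b
    have h := Nat.choose_mul_factorial_mul_factorial (Nat.le_add_right a b)
    rw [Nat.add_sub_cancel_left] at h
    exact_mod_cast h.symm
  have hf : ∀ a : ℕ, (a.factorial : ℂ) ≠ 0 := fun a => by exact_mod_cast a.factorial_ne_zero
  have hc : ∀ a b : ℕ, ((a + b).choose a : ℂ) ≠ 0 := fun a b => by
    exact_mod_cast (Nat.choose_pos (Nat.le_add_right a b)).ne'
  have h1 : ((i1 + i2 + 1 : ℕ) : ℂ) ≠ 0 := Nat.cast_ne_zero.mpr (Nat.succ_ne_zero _)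
  have h2 : ((i1 + 1 : ℕ) : ℂ) ≠ 0 := Nat.cast_ne_zero.mpr (Nat.succ_ne_zero _)
  have := hf i1
  have := hf i2
  have := hf j1
  have := hf j2
  have := hc i1 i2
  have := hc j1 j2
  simp only [normFactor, Nat.factorial_succ, pow_add, Nat.cast_mul, key]
  field_simp

/-- This is `allSum_succ` after normalization; the index `i.1` is the size of the component of the
marked point. -/
theorem allTerm_recursion {d : ℕ} (hd : 1 ≤ d) (x : ℕ × ℕ) :
    (x.1 : ℂ) • allTerm d x = ∑ i ∈ antidiagonal x.1, ∑ j ∈ antidiagonal x.2,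
      ((i.1 : ℂ) • connTerm d (i.1, j.1)) * allTerm d (i.2, j.2) := by
  obtain ⟨n, k⟩ := x
  rcases n with _ | n
  · simp
  rw [Finset.Nat.sum_antidiagonal_succ]
  simp only [Nat.cast_zero, zero_smul, zero_mul, Finset.sum_const_zero, zero_add]
  rw [allTerm]
  dsimp only
  rw [allSum_succ hd, smul_smul, Finset.mul_sum, Finset.smul_sum]
  refine Finset.sum_congr rfl fun i hi => ?_
  rw [Finset.smul_sum, Finset.mul_sum, Finset.smul_sum]
  refine Finset.sum_congr rfl fun j hj => ?_
  obtain ⟨i1, i2⟩ := i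
  obtain ⟨j1, j2⟩ := j
  obtain rfl : i1 + i2 = n := mem_antidiagonal.mp hi
  obtain rfl : j1 + j2 = k := mem_antidiagonal.mp hj
  dsimp only
  simp only [connTerm, allTerm, ← Nat.cast_smul_eq_nsmul ℂ, mul_smul_comm, smul_mul_assoc,
    smul_smul, pow_add]
  congr 1
  · rw [← normFactor_mul hd]
    ring
  · ring

/-- Both sides satisfy the Euler equation with multiplier `euler (connSeries d)`, so it suffices to
compare matrix degree zero. -/
theorem allSeries_eq_exp {d : ℕ} (hd : 1 ≤ d) :
    gradedSum (allTerm d) = expSeries (connSeries d) := by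
  classical
  refine eq_of_euler_eq (noConst_connSeries d).euler ?_ (noConst_connSeries d).euler_expSeries ?_
  · rw [euler_connSeries, gradedSum_mul (fun x => (Hom.connTerm d x).smul _) (Hom.allTerm d)]
    ext m
    rw [coeff_euler, coeff_gradedSum, coeff_gradedSum, ← MvPowerSeries.coeff_smul,
      allTerm_recursion hd]
  · intro m hm
    rw [(noConst_connSeries d).coeff_expSeries m 1 (by omega), coeff_gradedSum]
    obtain ⟨n, k, h⟩ : ∃ n k, bideg m = (n, k) := ⟨_, _, rfl⟩
    rw [h] at hm ⊢
    obtain rfl : n = 0 := hm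
    rcases k with _ | k
    · have hm0 : m = 0 := eq_zero_of_bideg m h
      have : permSum (1 : Equiv.Perm (Fin 0)) = 1 := by rw [permSum_one]; simp
      simp [hm0, allTerm, normFactor, allSum, wordSum, wordPerm, this]
    · have hm0 : m ≠ 0 := by
        rintro rfl
        rw [map_zero] at h
        exact absurd (congrArg Prod.snd h) (by simp)
      -- On no points there are no letters, so only the empty word contributes.
      have : IsEmpty (Fin d ↪ Fin 0) := ⟨fun f => (f ⟨0, hd⟩).elim0⟩
      simp [allTerm, allSum, wordSum, MvPowerSeries.coeff_one, hm0]

/-! ### The initial condition -/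

theorem hom_p_one_pow (n : ℕ) : Hom (n, 0) (p 1 ^ n) := by
  have h := Hom.permSum (1 : Equiv.Perm (Fin n))
  rwa [permSum_one, Fintype.card_fin] at h

theorem noConst_p_one : NoConst (p 1) := by
  intro m hm
  by_contra hne
  have h := hom_p_one_pow 1
  rw [pow_one] at h
  rw [h m hne] at hm
  simp at hm

/-- At z = 0 only empty words survive; on n points the empty word gives the identity, hence p_1^n /
n!. -/
theorem atZero_allSeries (d : ℕ) : atZero (gradedSum (allTerm d)) = expSeries (p 1) := by
  ext m
  have hl : coeff m (atZero (gradedSum (allTerm d))) =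
      if m Var.z = 0 then coeff m (gradedSum (allTerm d)) else 0 := rfl
  rw [hl, noConst_p_one.coeff_expSeries m ((bideg m).1 + 1) (by omega), coeff_gradedSum]
  have hz : ∀ n, bideg m ≠ (n, 0) → 1 / (n.factorial : ℂ) * coeff m (p 1 ^ n) = 0 := by
    intro n hn
    by_contra hne
    exact hn (hom_p_one_pow n m (right_ne_zero_of_mul hne))
  rw [← bideg_snd]
  obtain ⟨n, k, h⟩ : ∃ n k, bideg m = (n, k) := ⟨_, _, rfl⟩
  rw [h] at hz ⊢
  dsimp only
  split_ifs with hk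
  · subst hk
    rw [Finset.sum_eq_single n]
    · rw [allTerm, allSum, wordSum, MvPowerSeries.coeff_smul]
      simp [wordPerm, permSum_one, normFactor]
    · intro j _ hj
      exact hz j fun he => hj (congrArg Prod.fst he).symm
    · intro hn
      exact absurd (Finset.mem_range.mpr (Nat.lt_succ_self n)) hn
  · refine (Finset.sum_eq_zero fun j _ => hz j fun he => hk ?_).symm
    exact congrArg Prod.snd he

/-! ### Words of permutations -/

section Transitive

/-- A word of permutations is transitive if only the empty set and the whole set are invariant. -/
def Trans {V : Type} (l : List (Equiv.Perm V)) : Prop :=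
  ∀ S : Set V, S.Nonempty → (∀ τ ∈ l, ∀ x ∈ S, τ x ∈ S) → S = Set.univ

theorem trans_iff_isPretransitive {V : Type} [Finite V] (l : List (Equiv.Perm V)) :
    Trans l ↔ MulAction.IsPretransitive (Subgroup.closure {τ | τ ∈ l}) V := by
  constructor
  · intro h
    refine ⟨fun x y => ?_⟩
    have hS := h (MulAction.orbit (Subgroup.closure {τ | τ ∈ l}) x) ⟨x, MulAction.mem_orbit_self x⟩
      (by
        rintro τ hτ _ ⟨g, rfl⟩
        exact ⟨⟨τ, Subgroup.subset_closure hτ⟩ * g, rfl⟩)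
    have hy : y ∈ MulAction.orbit (Subgroup.closure {τ | τ ∈ l}) x := hS ▸ Set.mem_univ y
    exact hy
  · intro h S ⟨s, hs⟩ hS
    have key : ∀ g ∈ Subgroup.closure {τ | τ ∈ l}, ∀ x, x ∈ S ↔ g x ∈ S := by
      intro g hg
      induction hg using Subgroup.closure_induction with
      | mem τ hτ =>
        intro x
        refine ⟨hS τ hτ x, fun hx => ?_⟩
        -- Finiteness of `V` enters here: a forward invariant set is also invariant under the
        -- inverse.
        have := Equiv.Perm.perm_symm_mapsTo_of_mapsTo τ (s := S) (fun x hx => hS τ hτ x hx) hx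
        simpa using this
      | one => simp
      | mul a b _ _ ha hb =>
        intro x
        rw [hb x, ha (b x)]
        rfl
      | inv a _ ha =>
        intro x
        rw [ha (a⁻¹ x)]
        simp
    ext y
    obtain ⟨g, hg⟩ := h.exists_smul_eq s y
    have h2 := (key g g.2 s).mp hs
    have h3 : (g : Equiv.Perm V) s = y := hg
    rw [h3] at h2
    simp [h2]

variable {V : Type} [DecidableEq V] {d : ℕ}

theorem closed_iff_cyc (hd : 1 ≤ d) (w : List (Fin d ↪ V)) (S : Set V) :
    Closed w S ↔ ∀ τ ∈ w.map cyc, ∀ x ∈ S, τ x ∈ S := by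
  constructor
  · intro h τ hτ x hx
    obtain ⟨f, hf, rfl⟩ := List.mem_map.mp hτ
    by_cases hr : x ∈ Set.range f
    · obtain ⟨i, rfl⟩ := hr
      rw [cyc_apply]
      exact h f hf _ _ hx
    · rwa [cyc_apply_of_notMem f hr]
  · intro h f hf i j hi
    obtain ⟨e, rfl⟩ : ∃ e, d = e + 1 := ⟨d - 1, by omega⟩
    -- Repeated application of `cyc f` carries `f i` around the cycle, and j - i steps reach `f j`.
    have key : ∀ m : ℕ, f (i + Fin.ofNat (e + 1) m) ∈ S := by
      intro m
      induction m with
      | zero => simpa using hi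
      | succ m ih =>
        have := h _ (List.mem_map_of_mem hf) _ ih
        rw [cyc_apply, finRotate_apply] at this
        have hs : i + Fin.ofNat (e + 1) m + 1 = i + Fin.ofNat (e + 1) (m + 1) := by
          ext
          simp [Fin.val_add, Nat.add_assoc]
        rwa [hs] at this
    have h1 := key (j - i).val
    have h2 : Fin.ofNat (e + 1) (j - i).val = j - i := Fin.ext (Nat.mod_eq_of_lt (j - i).isLt)
    rwa [h2, add_sub_cancel] at h1

theorem conn_iff_trans (hd : 1 ≤ d) (w : List (Fin d ↪ V)) : Conn w ↔ Trans (w.map cyc) := by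
  simp only [Conn, Trans, closed_iff_cyc hd]

end Transitive

/-! ### From embeddings to d-cycles -/

section Cycles

variable {V : Type} [Fintype V] [DecidableEq V] {d : ℕ}

theorem parts_cyc (hd : 1 ≤ d) (f : Fin d ↪ V) :
    (cyc f).partition.parts = cycleParts (Fintype.card V) d := by
  have hcard : d ≤ Fintype.card V := by simpa using Fintype.card_le_of_embedding f
  have hc : (cyc f).cycleType = (finRotate d).cycleType :=
    Equiv.Perm.cycleType_extendDomain f.toEquivRange
  rw [Equiv.Perm.parts_partition, ← Equiv.Perm.sum_cycleType, hc, cycleParts]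
  obtain rfl | h2 : d = 1 ∨ 2 ≤ d := by omega
  · rw [Subsingleton.elim (finRotate 1) 1, Equiv.Perm.cycleType_one, ← Multiset.replicate_succ]
    simp only [Multiset.sum_zero, zero_add]
    congr 1
    omega
  · rw [cycleType_finRotate_of_le h2]
    simp

theorem cycleType_of_parts (n : ℕ) {τ : Equiv.Perm V} (h : τ.partition.parts = cycleParts n d) :
    τ.cycleType = if 2 ≤ d then {d} else 0 := by
  rw [← Equiv.Perm.filter_parts_partition_eq_cycleType, h, cycleParts]
  have h0 : (Multiset.replicate (n - d) 1).filter (2 ≤ ·) = 0 :=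
    Multiset.filter_eq_nil.mpr fun a ha => by rw [Multiset.eq_of_mem_replicate ha]; omega
  split_ifs with h2
  · rw [Multiset.filter_cons_of_pos _ h2, h0]
    rfl
  · rw [Multiset.filter_cons_of_neg _ h2, h0]

theorem cyc_pow_apply {V : Type} [DecidableEq V] {e : ℕ} (f : Fin (e + 1) ↪ V) (i : Fin (e + 1)) :
    (cyc f ^ (i : ℕ)) (f 0) = f i := by
  induction i using Fin.induction with
  | zero => simp
  | succ i ih =>
    rw [Fin.val_castSucc] at ih
    rw [Fin.val_succ, pow_succ', Equiv.Perm.mul_apply, ih, cyc_apply, finRotate_apply,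
      Fin.coeSucc_eq_succ]

/-- An embedding with cycle τ is determined by `f 0`, which can be any of the d points moved by τ.
-/
theorem card_fiber_cyc (hd : 2 ≤ d) (n : ℕ) (τ : Equiv.Perm V)
    (h : τ.partition.parts = cycleParts n d) :
    (Finset.univ.filter fun f : Fin d ↪ V => cyc f = τ).card = d := by
  obtain ⟨e, rfl⟩ : ∃ e, d = e + 1 := ⟨d - 1, by omega⟩
  have hct := cycleType_of_parts n h
  rw [if_pos hd] at hct
  have hcyc : τ.IsCycle := by
    rw [← Equiv.Perm.card_cycleType_eq_one, hct, Multiset.card_singleton]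
  have hsupp : τ.support.card = e + 1 := by
    rw [← Equiv.Perm.sum_cycleType, hct, Multiset.sum_singleton]
  have hord : orderOf τ = e + 1 := by rw [hcyc.orderOf, hsupp]
  refine (Finset.card_bij (fun f _ => f 0) ?_ ?_ ?_).trans hsupp
  · intro f hf
    rw [← (Finset.mem_filter.mp hf).2, Equiv.Perm.mem_support, cyc_apply, finRotate_apply]
    intro h0
    have h1 := congrArg Fin.val (f.injective h0)
    rw [zero_add, Fin.val_one', Fin.val_zero, Nat.mod_eq_of_lt hd] at h1
    omega
  · intro f hf g hg hfg
    ext i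
    have h1 := cyc_pow_apply f i
    have h2 := cyc_pow_apply g i
    rw [(Finset.mem_filter.mp hf).2] at h1
    rw [(Finset.mem_filter.mp hg).2] at h2
    rw [← h1, ← h2, hfg]
  · intro x hx
    have hx' := Equiv.Perm.mem_support.mp hx
    have hinj : Function.Injective fun i : Fin (e + 1) => (τ ^ (i : ℕ)) x := by
      have aux : ∀ i j : Fin (e + 1), i ≤ j → (τ ^ (i : ℕ)) x = (τ ^ (j : ℕ)) x → i = j := by
        intro i j hij heq
        have hp : (τ ^ ((j : ℕ) - i)) x = x := by
          apply (τ ^ (i : ℕ)).injective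
          rw [← Equiv.Perm.mul_apply, ← pow_add, Nat.add_sub_cancel' hij, heq]
        have h1 : τ ^ ((j : ℕ) - i) = 1 := hcyc.pow_eq_one_iff.mpr ⟨x, hx', hp⟩
        have h2 := orderOf_dvd_of_pow_eq_one h1
        rw [hord] at h2
        have h3 := Nat.eq_zero_of_dvd_of_lt h2 (by omega)
        have h4 : (i : ℕ) ≤ j := hij
        exact Fin.ext (by omega)
      intro i j hij
      rcases le_total i j with h | h
      · exact aux i j h hij
      · exact (aux j i h hij.symm).symm
    let f : Fin (e + 1) ↪ V := ⟨fun i => (τ ^ (i : ℕ)) x, hinj⟩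
    refine ⟨f, Finset.mem_filter.mpr ⟨Finset.mem_univ _, ?_⟩, by simp [f]⟩
    have hrange : Finset.univ.map f = τ.support := by
      refine Finset.eq_of_subset_of_card_le ?_ (by simp [hsupp])
      intro y hy
      obtain ⟨i, -, rfl⟩ := Finset.mem_map.mp hy
      exact Equiv.Perm.pow_apply_mem_support.mpr hx
    ext y
    by_cases hy : y ∈ Set.range f
    · obtain ⟨i, rfl⟩ := hy
      rw [cyc_apply, finRotate_apply]
      change (τ ^ ((i + 1 : Fin (e + 1)) : ℕ)) x = τ ((τ ^ (i : ℕ)) x)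
      rw [Fin.val_add, Fin.val_one', Nat.add_mod_mod,
        -- Closing the cycle: indices wrap modulo e + 1, which is the order of τ.
        show (i + 1 : ℕ) % (e + 1) = (i + 1 : ℕ) % orderOf τ by rw [hord],
        pow_mod_orderOf, pow_succ', Equiv.Perm.mul_apply]
    · rw [cyc_apply_of_notMem f hy]
      have : y ∉ τ.support := by
        rw [← hrange]
        simpa using hy
      exact (Equiv.Perm.notMem_support.mp this).symm

-- For d ≥ 2 every d-cycle comes from d embeddings. For d = 1 the identity comes from |V|
-- embeddings, the right number only if |V| = 1; on more points both sides vanish, since singletons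
-- are closed and invariant.
open scoped Classical in
theorem connSum_eq (hd : 1 ≤ d) [Nonempty V] {n : ℕ} (hn : Fintype.card V = n) (k : ℕ) :
    connSum d V k = d ^ k • wordSum k fun l : List (Equiv.Perm V) =>
      if (∀ τ ∈ l, τ.partition.parts = cycleParts n d) ∧ Trans l then
        permSum l.prod else 0 := by
  subst hn
  by_cases hc : 2 ≤ d ∨ Fintype.card V = 1
  · rw [← wordSum_map cyc (fun τ => τ.partition.parts = cycleParts (Fintype.card V) d) d]
    · rw [connSum]
      congr 1
      funext w
      refine if_congr ?_ rfl rfl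
      rw [conn_iff_trans hd]
      refine (and_iff_right ?_).symm
      intro τ hτ
      obtain ⟨f, -, rfl⟩ := List.mem_map.mp hτ
      exact parts_cyc hd f
    · intro τ hτ
      by_cases h2 : 2 ≤ d
      · convert card_fiber_cyc h2 _ τ hτ
      · obtain rfl : d = 1 := by omega
        have h1 : Fintype.card V = 1 := hc.resolve_left h2
        have : Subsingleton V := Fintype.card_le_one_iff_subsingleton.mp h1.le
        rw [Finset.filter_true_of_mem fun f _ => Subsingleton.elim _ _, Finset.card_univ,
          Fintype.card_embedding_eq, h1]
        rfl
    · intro l hl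
      by_contra h
      exact hl (if_neg fun h' => h h'.1)
  · obtain rfl : d = 1 := by omega
    have hV : ∀ x : V, ({x} : Set V) ≠ Set.univ := by
      intro x h
      apply hc
      right
      rw [Fintype.card_eq_one_iff]
      exact ⟨x, fun y => by
        have : y ∈ ({x} : Set V) := h ▸ Set.mem_univ y
        exact this⟩
    obtain ⟨x⟩ := ‹Nonempty V›
    have h1 : (fun w : List (Fin 1 ↪ V) => if Conn w then permSum (wordPerm w) else 0) =
        fun _ => 0 := by
      funext w
      refine if_neg fun h => hV x (h _ ⟨x, rfl⟩ ?_)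
      intro f _ i j hi
      rwa [Subsingleton.elim j i]
    have h2 : (fun l : List (Equiv.Perm V) =>
        if (∀ τ ∈ l, τ.partition.parts = cycleParts (Fintype.card V) 1) ∧ Trans l then
        permSum l.prod else 0) = fun _ => 0 := by
      funext l
      refine if_neg fun h => hV x (h.2 _ ⟨x, rfl⟩ ?_)
      intro τ hτ y hy
      have h3 := cycleType_of_parts _ (h.1 τ hτ)
      rw [if_neg (by omega), Equiv.Perm.cycleType_eq_zero] at h3
      rwa [h3]
    rw [connSum, h1, h2, wordSum_zero_fun, wordSum_zero_fun, smul_zero]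

end Cycles

/-! ### Hurwitz numbers -/

/-- The last permutation is the inverse of the product of the others: it has the cycle type of that
product and adds nothing to the generated subgroup. -/
theorem hurwitz_eq_card (d k : ℕ) {n : ℕ} (α : n.Partition) :
    hurwitz d k α = Nat.card {s : Fin k → Equiv.Perm (Fin n) //
      ((∀ τ ∈ List.ofFn s, τ.partition.parts = cycleParts n d) ∧ Trans (List.ofFn s)) ∧
        (List.ofFn s).prod.partition.parts = α.parts} := by
  have hprod : ∀ (s : Fin k → Equiv.Perm (Fin n)) (g : Equiv.Perm (Fin n)),
      (List.ofFn (Fin.snoc (α := fun _ => Equiv.Perm (Fin n)) s g)).prod =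
        (List.ofFn s).prod * g := by
    intro s g
    rw [List.ofFn_succ']
    simp
  have hinv : ∀ τ : Equiv.Perm (Fin n), τ⁻¹.partition.parts = τ.partition.parts := by
    intro τ
    rw [Equiv.Perm.parts_partition, Equiv.Perm.parts_partition, Equiv.Perm.cycleType_inv,
      Equiv.Perm.support_inv]
  have hclos : ∀ (s : Fin k → Equiv.Perm (Fin n)),
      Subgroup.closure (Set.range (Fin.snoc (α := fun _ => Equiv.Perm (Fin n)) s
        (List.ofFn s).prod⁻¹)) = Subgroup.closure {τ | τ ∈ List.ofFn s} := by
    intro s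
    apply le_antisymm
    · rw [Subgroup.closure_le]
      rintro _ ⟨i, rfl⟩
      induction i using Fin.lastCases with
      | last =>
        rw [Fin.snoc_last]
        exact inv_mem (list_prod_mem fun τ hτ => Subgroup.subset_closure hτ)
      | cast i =>
        rw [Fin.snoc_castSucc]
        exact Subgroup.subset_closure (List.mem_ofFn.mpr ⟨i, rfl⟩)
    · refine Subgroup.closure_mono ?_
      intro τ hτ
      obtain ⟨i, rfl⟩ := List.mem_ofFn.mp hτ
      exact ⟨i.castSucc, by rw [Fin.snoc_castSucc]⟩
  have hiff : ∀ (s : Fin k → Equiv.Perm (Fin n)),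
      ((∀ i, ((Fin.snoc (α := fun _ => Equiv.Perm (Fin n)) s (List.ofFn s).prod⁻¹ :
          Fin (k + 1) → Equiv.Perm (Fin n)) i).partition.parts =
        (Fin.snoc (α := fun _ => Multiset ℕ) (fun _ : Fin k => cycleParts n d) α.parts :
          Fin (k + 1) → Multiset ℕ) i) ∧
        (List.ofFn (Fin.snoc (α := fun _ => Equiv.Perm (Fin n)) s (List.ofFn s).prod⁻¹)).prod = 1 ∧
        MulAction.IsPretransitive (Subgroup.closure (Set.range
          (Fin.snoc (α := fun _ => Equiv.Perm (Fin n)) s (List.ofFn s).prod⁻¹))) (Fin n)) ↔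
      ((∀ τ ∈ List.ofFn s, τ.partition.parts = cycleParts n d) ∧ Trans (List.ofFn s)) ∧
        (List.ofFn s).prod.partition.parts = α.parts := by
    intro s
    rw [hprod, mul_inv_cancel, hclos, ← trans_iff_isPretransitive, Fin.forall_fin_succ']
    simp only [Fin.snoc_castSucc, Fin.snoc_last, hinv, List.forall_mem_ofFn_iff]
    tauto
  have hsnoc : ∀ σ : Fin (k + 1) → Equiv.Perm (Fin n), (List.ofFn σ).prod = 1 →
      Fin.snoc (α := fun _ => Equiv.Perm (Fin n)) (Fin.init σ)
        (List.ofFn (Fin.init σ)).prod⁻¹ = σ := by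
    intro σ hσ
    have h := hprod (Fin.init σ) (σ (Fin.last k))
    rw [Fin.snoc_init_self, hσ] at h
    rw [inv_eq_of_mul_eq_one_right h.symm, Fin.snoc_init_self]
  rw [hurwitz, Cov]
  refine Nat.card_congr
    { toFun := fun σ => ⟨Fin.init σ.1, (hiff _).mp (by rw [hsnoc σ.1 σ.2.2.1]; exact σ.2)⟩
      invFun := fun s => ⟨_, (hiff s.1).mpr s.2⟩
      left_inv := fun σ => Subtype.ext (hsnoc σ.1 σ.2.2.1)
      right_inv := fun s => Subtype.ext (Fin.init_snoc (α := fun _ => Equiv.Perm (Fin n)) _ _) }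

open scoped Classical in
theorem sum_hurwitz (d k n : ℕ) :
    ∑ α : n.Partition, (hurwitz d k α : ℂ) • pPart α =
      wordSum k fun l : List (Equiv.Perm (Fin n)) =>
        if (∀ τ ∈ l, τ.partition.parts = cycleParts n d) ∧ Trans l then permSum l.prod else 0 := by
  rw [wordSum_eq_sum]
  have h : ∀ α : n.Partition, (hurwitz d k α : ℂ) • pPart α =
      ∑ s : Fin k → Equiv.Perm (Fin n),
        if (∀ τ ∈ List.ofFn s, τ.partition.parts = cycleParts n d) ∧ Trans (List.ofFn s) then
          if (List.ofFn s).prod.partition.parts = α.parts then pPart α else 0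
        else 0 := by
    intro α
    simp only [← ite_and]
    rw [hurwitz_eq_card, Nat.card_eq_fintype_card, Fintype.card_subtype, ← Finset.sum_filter,
      Finset.sum_const, Nat.cast_smul_eq_nsmul]
  simp only [h]
  rw [Finset.sum_comm]
  refine Finset.sum_congr rfl fun s _ => ?_
  split_ifs with hs
  · let α₀ : n.Partition := ⟨(List.ofFn s).prod.partition.parts,
      fun {i} hi => (List.ofFn s).prod.partition.parts_pos hi, by
        rw [(List.ofFn s).prod.partition.parts_sum, Fintype.card_fin]⟩
    rw [Finset.sum_eq_single α₀, if_pos rfl, permSum_eq]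
    · rfl
    · intro α _ hα
      exact if_neg fun h => hα (Nat.Partition.ext h.symm)
    · intro h
      exact absurd (Finset.mem_univ _) h
  · exact Finset.sum_const_zero

/-- The d^k in `normFactor` cancels the d^k choices of embeddings for k given d-cycles. -/
theorem hTerm_eq {d : ℕ} (hd : 1 ≤ d) (q : ℕ+ × ℕ) : hTerm d q = connTerm d (q.1, q.2) := by
  obtain ⟨n, k⟩ := q
  have hd' : (d : ℂ) ≠ 0 := by exact_mod_cast (show d ≠ 0 by omega)
  have : Nonempty (Fin (n : ℕ)) := ⟨⟨0, n.pos⟩⟩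
  rw [connTerm]
  dsimp only
  rw [connSum_eq hd (Fintype.card_fin n), ← sum_hurwitz, hTerm, ← Nat.cast_smul_eq_nsmul ℂ,
    mul_smul_comm, smul_smul, Finset.mul_sum, Finset.smul_sum]
  refine Finset.sum_congr rfl fun α _ => ?_
  rw [mul_smul_comm, smul_smul, normFactor]
  congr 1
  have h1 : ((n : ℕ).factorial : ℂ) ≠ 0 := by exact_mod_cast (n : ℕ).factorial_ne_zero
  have h2 : (k.factorial : ℂ) ≠ 0 := by exact_mod_cast k.factorial_ne_zero
  push_cast
  field_simp

theorem H_eq_connSeries {d : ℕ} (hd : 1 ≤ d) : H d = connSeries d := by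
  ext m
  rw [H, coeff_formalSum, connSeries, coeff_gradedSum]
  simp only [hTerm_eq hd]
  have hz : ∀ q : ℕ+ × ℕ, ((q.1 : ℕ), q.2) ≠ bideg m →
      coeff m (connTerm d ((q.1 : ℕ), q.2)) = 0 := by
    intro q hq
    by_contra hne
    exact hq (Hom.connTerm d _ m hne).symm
  obtain ⟨n, k, h⟩ : ∃ n k, bideg m = (n, k) := ⟨_, _, rfl⟩
  rw [h] at hz ⊢
  dsimp only
  split_ifs with hn
  · rw [map_zero]
    refine finsum_eq_zero_of_forall_eq_zero fun q => hz q fun he => ?_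
    exact q.1.ne_zero ((congrArg Prod.fst he).trans hn)
  · rw [finsum_eq_single _ ((⟨n, Nat.pos_of_ne_zero hn⟩, k) : ℕ+ × ℕ)]
    · rfl
    · intro q hq
      refine hz q fun he => hq ?_
      exact Prod.ext (PNat.eq (congrArg Prod.fst he :)) (congrArg Prod.snd he :)

theorem Hhat_eq {d : ℕ} (hd : 1 ≤ d) : Hhat d = gradedSum (allTerm d) := by
  rw [Hhat, H_eq_connSeries hd, allSeries_eq_exp hd]

end WOp

theorem theorem52 (d : ℕ) (hd : 1 ≤ d) :
    WOp.dz (WOp.Hhat d) = WOp.W d (WOp.Hhat d) ∧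
    WOp.atZero (WOp.Hhat d) = WOp.expSeries (WOp.p 1) ∧
    ∀ F : WOp.Ser, WOp.dz F = WOp.W d F → WOp.atZero F = WOp.expSeries (WOp.p 1) →
      F = WOp.Hhat d := by
  have h1 : WOp.dz (WOp.Hhat d) = WOp.W d (WOp.Hhat d) := by
    rw [WOp.Hhat_eq hd, WOp.dz_allSeries hd]
  have h2 : WOp.atZero (WOp.Hhat d) = WOp.expSeries (WOp.p 1) := by
    rw [WOp.Hhat_eq hd, WOp.atZero_allSeries]
  exact ⟨h1, h2, fun F hF hF0 => WOp.eq_of_dz_eq_W hF h1 (hF0.trans h2.symm)⟩
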